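/- Work in the two-sorted language $\mathcal L^2_{PA}=\{0,1,+,\cdot,|\ |,=_1,=_2,\le,\in\}$, with number variables and variables for finite sets. A formula is $\Sigma^{1,b}_0$ if it has no set quantifiers and all its number quantifiers are bounded; $\Sigma^{1,b}_1$ and $\Pi^{1,b}_1$ are the smallest classes that contain the $\Sigma^{1,b}_0$-formulas, are closed under $\wedge,\vee$, are exchanged by negation, and are closed under $\exists X\le t$ and $\forall X\le t$ (where $|X|\le t$) respectively. The theory $V^1$ consists of the axioms $2$-BASIC, the comprehension axioms $\forall x\,\exists X\le x\,\forall y<x\,(y\in X\leftrightarrow\phi(y))$ for $\Sigma^{1,b}_0$-formulas $\phi$, and the number induction axioms for $\Sigma^{1,b}_1$-formulas. Put $\langle x,y\rangle=\frac{(x+y)(x+y+1)}2+y$, code tuples by $\langle x_1,\dots,x_k\rangle=\langle\langle x_1,\dots,x_{k-1}\rangle,x_k\rangle$, and write $X(x_1,\dots,x_k)$ for $\langle x_1,\dots,x_k\rangle\in X$. An instance $\Theta=(\mathcal X,\ddot{\mathcal A})$ with parameters $n,l$ consists of an input digraph $\mathcal X=(V_{\mathcal X},E_{\mathcal X})$ with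 $V_{\mathcal X}=\{0,\dots,n-1\}$ and $E_{\mathcal X}$ a binary relation on $V_{\mathcal X}$, and of a target digraph with domains $\ddot{\mathcal A}=(V_{\ddot{\mathcal A}},E_{\ddot{\mathcal A}})$, where $V_{\ddot{\mathcal A}}$ is a set of pairs $\langle i,a\rangle$ with $i<n$, $a<l$, which codes the domains $D_i=\{a<l: V_{\ddot{\mathcal A}}(i,a)\}$, and $E_{\ddot{\mathcal A}}$ is a set of pairs $\langle\langle i,a\rangle,\langle j,b\rangle\rangle$ with $i,j<n$, $a\in D_i$, $b\in D_j$; write $E^{ij}_{\ddot{\mathcal A}}(a,b)$ for $E_{\ddot{\mathcal A}}(\langle i,a\rangle,\langle j,b\rangle)$. A solution of $\Theta$ is (a set $H\le\langle n,\langle n,l\rangle\rangle$ coding) a map $V_{\mathcal X}\to V_{\ddot{\mathcal A}}$ that sends each $i$ to some $\langle i,a\rangle$ with $a\in D_i$ and edges of $\mathcal X$ to edges of $\ddot{\mathcal A}$. The instance $\Theta_{cc}=(\mathcal X,\ddot{\mathcal A}_{cc})$ is obtained from $\Theta$ as follows, where $i,j,k<n$ and $a,b,c<l$. 1. $E^{ij}_{0}(a,b)$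 iff $a\in D_i$, $b\in D_j$, $E_{\mathcal X}(i,j)\to E^{ij}_{\ddot{\mathcal A}}(a,b)$ and $E_{\mathcal X}(j,i)\to E^{ji}_{\ddot{\mathcal A}}(b,a)$. 2. $Pr_1(i,a)$ iff $a\in D_i$, for every $j$ with $E_{\mathcal X}(i,j)$ there is $b\in D_j$ with $E_0^{ij}(a,b)$, and for every $k$ with $E_{\mathcal X}(k,i)$ there is $c\in D_k$ with $E_0^{ki}(c,a)$. 3. $R_1(i,j,a,b)$ iff $Pr_1(i,a)$, $Pr_1(j,b)$ and $E_0^{ij}(a,b)$; let $q$ be the number of quadruples $(i,j,a,b)$ in $R_1$. 4. For $1\le t\le q$: $R_{t+1}(i,j,a,b)$ iff $R_t(i,j,a,b)$ and for every $k$ there is $c$ with $Pr_1(k,c)$, $R_t(i,k,a,c)$ and $R_t(k,j,c,b)$. 5. $Pr_{cc}(i,a)$ iff $Pr_1(i,a)$, for every $j$ with $E_{\mathcal X}(i,j)$ there is $b$ with $Pr_1(j,b)$ and $R_{q+1}(i,j,a,b)$, and for every $k$ with $E_{\mathcal X}(k,i)$ there is $c$ with $Pr_1(k,c)$ and $R_{q+1}(k,i,c,a)$.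 6. $V_{\ddot{\mathcal A}_{cc}}(i,a)$ iff $Pr_{cc}(i,a)$; and $E^{ij}_{\ddot{\mathcal A}_{cc}}(a,b)$ iff $Pr_{cc}(i,a)$, $Pr_{cc}(j,b)$ and $R_{q+1}(i,j,a,b)$. Then $V^1$ proves that for all $n,l$ and every instance $\Theta$ with these parameters, $\Theta_{cc}$ exists, and $\Theta$ has a solution if and only if $\Theta_{cc}$ has a solution. -/

import Mathlib

/-! # Two-sorted bounded arithmetic `V¹` and cycle-consistency reduction

The vocabulary is `{0, 1, +, ·, | |, =₁, =₂, ≤, ∈}`.  Variables of both sorts are de Bruijn indices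
(number variables and set variables are counted separately); the only terms of the set sort are
variables.  The connectives `⊥, →` and the quantifiers `∀x, ∀X` are primitive, the others are
the usual classical abbreviations. -/

namespace BA

/-- Number terms. `var k` is the `k`-th number variable, `len X` is `|X|` for the `X`-th
set variable. -/
inductive Term : Type
  | var (k : ℕ) : Term
  | zero : Term
  | one : Term
  | add (s t : Term) : Term
  | mul (s t : Term) : Term
  | len (X : ℕ) : Term

/-- Two-sorted formulas; `allN` binds number variable `0`, `allS` binds set variable `0`. -/
inductive Fml : Type
  | falsum : Fml
  | eqN (s t : Term) : Fml
  | eqS (X Y : ℕ) : Fml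
  | le (s t : Term) : Fml
  | mem (t : Term) (X : ℕ) : Fml
  | imp (φ ψ : Fml) : Fml
  | allN (φ : Fml) : Fml
  | allS (φ : Fml) : Fml

prefix:max "♯" => Term.var
infixl:65 " +ᶠ " => Term.add
infixl:70 " *ᶠ " => Term.mul
infix:50 " =ᶠ " => Fml.eqN
infix:50 " ≤ᶠ " => Fml.le
infix:50 " ∈ᶠ " => Fml.mem
infixr:25 " →ᶠ " => Fml.imp

def Fml.neg (φ : Fml) : Fml := φ →ᶠ Fml.falsum
def Fml.and (φ ψ : Fml) : Fml := Fml.neg (φ →ᶠ Fml.neg ψ)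
def Fml.or (φ ψ : Fml) : Fml := Fml.neg φ →ᶠ ψ

prefix:max "¬ᶠ" => Fml.neg
infixr:35 " ∧ᶠ " => Fml.and
infixr:30 " ∨ᶠ " => Fml.or

def Fml.iff (φ ψ : Fml) : Fml := (φ →ᶠ ψ) ∧ᶠ (ψ →ᶠ φ)

infix:20 " ↔ᶠ " => Fml.iff

def Fml.exN (φ : Fml) : Fml := ¬ᶠ(Fml.allN ¬ᶠφ)
def Fml.exS (φ : Fml) : Fml := ¬ᶠ(Fml.allS ¬ᶠφ)
def Fml.lt (s t : Term) : Fml := s ≤ᶠ t ∧ᶠ ¬ᶠ(s =ᶠ t)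

infix:50 " <ᶠ " => Fml.lt

/-! ## Substitution -/

/-- Simultaneous substitution of terms for number variables and of set variables for set
variables. -/
def Term.subst (σ : ℕ → Term) (ρ : ℕ → ℕ) : Term → Term
  | .var k => σ k
  | .zero => .zero
  | .one => .one
  | .add s t => .add (s.subst σ ρ) (t.subst σ ρ)
  | .mul s t => .mul (s.subst σ ρ) (t.subst σ ρ)
  | .len X => .len (ρ X)

/-- Weakening of a term by one number variable. -/
def Term.up (t : Term) : Term := t.subst (fun k => ♯(k + 1)) id

/-- Weakening of a term by one set variable. -/
def Term.upS (t : Term) : Term := t.subst Term.var Nat.succ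

/-- Extend a number substitution under a number quantifier. -/
def liftN (σ : ℕ → Term) : ℕ → Term
  | 0 => ♯0
  | k + 1 => (σ k).up

/-- Extend a set renaming under a set quantifier. -/
def liftS (ρ : ℕ → ℕ) : ℕ → ℕ
  | 0 => 0
  | k + 1 => ρ k + 1

/-- Capture-avoiding simultaneous substitution in a formula. -/
def Fml.subst : (ℕ → Term) → (ℕ → ℕ) → Fml → Fml
  | _, _, .falsum => .falsum
  | σ, ρ, .eqN s t => .eqN (s.subst σ ρ) (t.subst σ ρ)
  | _, ρ, .eqS X Y => .eqS (ρ X) (ρ Y)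
  | σ, ρ, .le s t => .le (s.subst σ ρ) (t.subst σ ρ)
  | σ, ρ, .mem t X => .mem (t.subst σ ρ) (ρ X)
  | σ, ρ, .imp φ ψ => .imp (φ.subst σ ρ) (ψ.subst σ ρ)
  | σ, ρ, .allN φ => .allN (φ.subst (liftN σ) ρ)
  | σ, ρ, .allS φ => .allS (φ.subst (fun k => (σ k).upS) (liftS ρ))

/-- Weakening of a formula by one number variable. -/
def Fml.up (φ : Fml) : Fml := φ.subst (fun k => ♯(k + 1)) id

/-- Weakening of a formula by one set variable. -/
def Fml.upS (φ : Fml) : Fml := φ.subst Term.var Nat.succ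

/-- The substitution `0 ↦ t`, `k + 1 ↦ k`. -/
def consN (t : Term) : ℕ → Term
  | 0 => t
  | k + 1 => ♯k

/-- The renaming `0 ↦ Y`, `k + 1 ↦ k`. -/
def consS (Y : ℕ) : ℕ → ℕ
  | 0 => Y
  | k + 1 => k

/-- `φ(t)`: instantiate number variable `0` by `t`. -/
def Fml.instN (φ : Fml) (t : Term) : Fml := φ.subst (consN t) id

/-- `φ(Y)`: instantiate set variable `0` by `Y`. -/
def Fml.instS (φ : Fml) (Y : ℕ) : Fml := φ.subst Term.var (consS Y)

/-- The substitution `0 ↦ x₀ + 1`, all other variables fixed. -/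
def succN : ℕ → Term
  | 0 => ♯0 +ᶠ Term.one
  | k + 1 => ♯(k + 1)

/-- `φ(x + 1)`, where `x` is number variable `0`. -/
def Fml.atSucc (φ : Fml) : Fml := φ.subst succN id

/-! ## Provability: classical natural deduction with equality for both sorts -/

/-- `Proves T Γ φ`: the formula `φ` is derivable from the axioms `T` (whose free variables are read
as universally quantified) and the finitely many hypotheses `Γ`. -/
inductive Proves (T : Set Fml) : List Fml → Fml → Prop
  | ax {Γ : List Fml} {φ : Fml} : φ ∈ T → Proves T Γ φ
  | hyp {Γ : List Fml} {φ : Fml} : φ ∈ Γ → Proves T Γ φ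
  | impI {Γ : List Fml} {φ ψ : Fml} : Proves T (φ :: Γ) ψ → Proves T Γ (φ →ᶠ ψ)
  | impE {Γ : List Fml} {φ ψ : Fml} : Proves T Γ (φ →ᶠ ψ) → Proves T Γ φ → Proves T Γ ψ
  | raa {Γ : List Fml} {φ : Fml} : Proves T (¬ᶠφ :: Γ) Fml.falsum → Proves T Γ φ
  | allNI {Γ : List Fml} {φ : Fml} : Proves T (Γ.map Fml.up) φ → Proves T Γ (Fml.allN φ)
  | allNE {Γ : List Fml} {φ : Fml} (t : Term) :
      Proves T Γ (Fml.allN φ) → Proves T Γ (φ.instN t)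
  | allSI {Γ : List Fml} {φ : Fml} : Proves T (Γ.map Fml.upS) φ → Proves T Γ (Fml.allS φ)
  | allSE {Γ : List Fml} {φ : Fml} (Y : ℕ) :
      Proves T Γ (Fml.allS φ) → Proves T Γ (φ.instS Y)
  | eqNRefl {Γ : List Fml} (t : Term) : Proves T Γ (t =ᶠ t)
  | eqNSubst {Γ : List Fml} (φ : Fml) {s t : Term} :
      Proves T Γ (s =ᶠ t) → Proves T Γ (φ.instN s) → Proves T Γ (φ.instN t)
  | eqSRefl {Γ : List Fml} (X : ℕ) : Proves T Γ (Fml.eqS X X)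
  | eqSSubst {Γ : List Fml} (φ : Fml) {X Y : ℕ} :
      Proves T Γ (Fml.eqS X Y) → Proves T Γ (φ.instS X) → Proves T Γ (φ.instS Y)

/-! ## Bounded quantifiers and the classes `Σ^{1,b}_0`, `Σ^{1,b}_1`, `Π^{1,b}_1` -/

/-- `∀ x ≤ t, φ` -/
def allLe (t : Term) (φ : Fml) : Fml := Fml.allN (♯0 ≤ᶠ t.up →ᶠ φ)
/-- `∃ x ≤ t, φ` -/
def exLe (t : Term) (φ : Fml) : Fml := Fml.exN (♯0 ≤ᶠ t.up ∧ᶠ φ)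
/-- `∀ x < t, φ` -/
def allLt (t : Term) (φ : Fml) : Fml := allLe t (♯0 <ᶠ t.up →ᶠ φ)
/-- `∃ x < t, φ` -/
def exLt (t : Term) (φ : Fml) : Fml := exLe t (♯0 <ᶠ t.up ∧ᶠ φ)
/-- `∀ X ≤ t, φ` -/
def allSLe (t : Term) (φ : Fml) : Fml := Fml.allS (Term.len 0 ≤ᶠ t.upS →ᶠ φ)
/-- `∃ X ≤ t, φ` -/
def exSLe (t : Term) (φ : Fml) : Fml := Fml.exS (Term.len 0 ≤ᶠ t.upS ∧ᶠ φ)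

/-- `Σ^{1,b}_0 = Π^{1,b}_0`: no set quantifiers, all number quantifiers bounded. -/
inductive Sigma0 : Fml → Prop
  | falsum : Sigma0 Fml.falsum
  | eqN (s t : Term) : Sigma0 (s =ᶠ t)
  | eqS (X Y : ℕ) : Sigma0 (Fml.eqS X Y)
  | le (s t : Term) : Sigma0 (s ≤ᶠ t)
  | mem (t : Term) (X : ℕ) : Sigma0 (t ∈ᶠ X)
  | imp {φ ψ : Fml} : Sigma0 φ → Sigma0 ψ → Sigma0 (φ →ᶠ ψ)
  | allLe (t : Term) {φ : Fml} : Sigma0 φ → Sigma0 (allLe t φ)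
  | exLe (t : Term) {φ : Fml} : Sigma0 φ → Sigma0 (exLe t φ)

mutual
/-- `Σ^{1,b}_1`.  Since `¬, ∧, ∨` are abbreviations through `→` and `⊥`, closure under `imp` (with
the classes exchanged in the premise) is closure under `∧`, `∨` and exchange of the classes under
`¬`; see the lemmas below. -/
inductive Sigma1 : Fml → Prop
  | of0 {φ : Fml} : Sigma0 φ → Sigma1 φ
  | imp {φ ψ : Fml} : Pi1 φ → Sigma1 ψ → Sigma1 (φ →ᶠ ψ)
  | exSLe (t : Term) {φ : Fml} : Sigma1 φ → Sigma1 (exSLe t φ)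
/-- `Π^{1,b}_1` -/
inductive Pi1 : Fml → Prop
  | of0 {φ : Fml} : Sigma0 φ → Pi1 φ
  | imp {φ ψ : Fml} : Sigma1 φ → Pi1 ψ → Pi1 (φ →ᶠ ψ)
  | allSLe (t : Term) {φ : Fml} : Pi1 φ → Pi1 (allSLe t φ)
end

theorem Sigma1.neg {φ : Fml} (h : Sigma1 φ) : Pi1 ¬ᶠφ := .imp h (.of0 .falsum)
theorem Pi1.neg {φ : Fml} (h : Pi1 φ) : Sigma1 ¬ᶠφ := .imp h (.of0 .falsum)
theorem Sigma1.and {φ ψ : Fml} (h : Sigma1 φ) (k : Sigma1 ψ) : Sigma1 (φ ∧ᶠ ψ) :=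
  Pi1.neg (.imp h k.neg)
theorem Sigma1.or {φ ψ : Fml} (h : Sigma1 φ) (k : Sigma1 ψ) : Sigma1 (φ ∨ᶠ ψ) := .imp h.neg k
theorem Pi1.and {φ ψ : Fml} (h : Pi1 φ) (k : Pi1 ψ) : Pi1 (φ ∧ᶠ ψ) :=
  Sigma1.neg (.imp h k.neg)
theorem Pi1.or {φ ψ : Fml} (h : Pi1 φ) (k : Pi1 ψ) : Pi1 (φ ∨ᶠ ψ) := .imp h.neg k

/-! ## The theory `V¹` -/

/-- The axioms of `V¹`: `2-BASIC` (`B1`-`B12`, `L1`, `L2`, `SE`), comprehension for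
`Σ^{1,b}_0`-formulas and number induction for `Σ^{1,b}_1`-formulas. -/
inductive V1 : Set Fml
  | B1 : V1 ¬ᶠ(♯0 +ᶠ .one =ᶠ .zero)
  | B2 : V1 (♯0 +ᶠ .one =ᶠ ♯1 +ᶠ .one →ᶠ ♯0 =ᶠ ♯1)
  | B3 : V1 (♯0 +ᶠ .zero =ᶠ ♯0)
  | B4 : V1 (♯0 +ᶠ (♯1 +ᶠ .one) =ᶠ (♯0 +ᶠ ♯1) +ᶠ .one)
  | B5 : V1 (♯0 *ᶠ .zero =ᶠ .zero)
  | B6 : V1 (♯0 *ᶠ (♯1 +ᶠ .one) =ᶠ (♯0 *ᶠ ♯1) +ᶠ ♯0)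
  | B7 : V1 (♯0 ≤ᶠ ♯1 ∧ᶠ ♯1 ≤ᶠ ♯0 →ᶠ ♯0 =ᶠ ♯1)
  | B8 : V1 (♯0 ≤ᶠ ♯0 +ᶠ ♯1)
  | B9 : V1 (.zero ≤ᶠ ♯0)
  | B10 : V1 (♯0 ≤ᶠ ♯1 ∨ᶠ ♯1 ≤ᶠ ♯0)
  | B11 : V1 (♯0 ≤ᶠ ♯1 ↔ᶠ ♯0 <ᶠ ♯1 +ᶠ .one)
  | B12 : V1 (¬ᶠ(♯0 =ᶠ .zero) →ᶠ exLe ♯0 (♯0 +ᶠ .one =ᶠ ♯1))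
  | L1 : V1 (♯0 ∈ᶠ 0 →ᶠ ♯0 <ᶠ .len 0)
  | L2 : V1 (♯0 +ᶠ .one =ᶠ .len 0 →ᶠ ♯0 ∈ᶠ 0)
  | SE : V1 ((.len 0 =ᶠ .len 1 ∧ᶠ allLt (.len 0) (♯0 ∈ᶠ 0 ↔ᶠ ♯0 ∈ᶠ 1)) ↔ᶠ .eqS 0 1)
  /-- `∀ x ∃ X ≤ x ∀ y < x (y ∈ X ↔ φ(y))`; in `φ`, the number variables `0` and `1` are `y` and
  `x`, and `X` does not occur. -/
  | comp {φ : Fml} : Sigma0 φ →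
      V1 (.allN (exSLe ♯0 (allLt ♯0 (♯0 ∈ᶠ 0 ↔ᶠ φ.upS))))
  /-- `φ(0) ∧ ∀ x (φ(x) → φ(x + 1)) → ∀ z φ(z)` -/
  | ind {φ : Fml} : Sigma1 φ →
      V1 (φ.instN .zero ∧ᶠ .allN (φ →ᶠ φ.atSucc) →ᶠ .allN φ)

/-! ## Coding pairs, tuples and functions by sets -/

/-- `⟨s, t⟩ = z`, where `⟨s, t⟩ = (s + t)(s + t + 1) / 2 + t`. -/
def isPair (s t z : Term) : Fml :=
  z +ᶠ z =ᶠ (s +ᶠ t) *ᶠ (s +ᶠ t +ᶠ .one) +ᶠ (t +ᶠ t)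

/-- A term that bounds `⟨s, t⟩`. -/
def pairBound (s t : Term) : Term := (s +ᶠ t +ᶠ .one) *ᶠ (s +ᶠ t +ᶠ .one)

/-- `X(s, t)`, that is, `⟨s, t⟩ ∈ X`. -/
def mem2 (X : ℕ) (s t : Term) : Fml :=
  exLt (.len X) (isPair s.up t.up ♯0 ∧ᶠ ♯0 ∈ᶠ X)

/-- `X(r, s, t)`, that is, `⟨⟨r, s⟩, t⟩ ∈ X` (a code in `X` and its components are `< |X|`). -/
def mem3 (X : ℕ) (r s t : Term) : Fml :=
  exLt (.len X) (isPair r.up s.up ♯0 ∧ᶠ mem2 X ♯0 t.up)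

/-- `X(q, r, s, t)` -/
def mem4 (X : ℕ) (q r s t : Term) : Fml :=
  exLt (.len X) (isPair q.up r.up ♯0 ∧ᶠ mem3 X ♯0 s.up t.up)

/-- `X(p, q, r, s, t)` -/
def mem5 (X : ℕ) (p q r s t : Term) : Fml :=
  exLt (.len X) (isPair p.up q.up ♯0 ∧ᶠ mem4 X ♯0 r.up s.up t.up)

/-- `X(⟨i, a⟩, ⟨j, b⟩)` -/
def memEdge (X : ℕ) (i a j b : Term) : Fml :=
  exLt (.len X) (exLt (.len X)
    (isPair i.up.up a.up.up ♯1 ∧ᶠ isPair j.up.up b.up.up ♯0 ∧ᶠ mem2 X ♯1 ♯0))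

/-- `C` codes (the graph of) the census function of `X`: on `{0, …, |X|}` it is a function, its
value at `0` is `0`, and it grows by one exactly at the elements of `X`. -/
def census (X C : ℕ) : Fml :=
  allLe (.len X) (exLe (.len X)
    (mem2 C ♯1 ♯0 ∧ᶠ allLe (.len X) (mem2 C ♯2 ♯0 →ᶠ ♯0 =ᶠ ♯1))) ∧ᶠ
  mem2 C .zero .zero ∧ᶠ
  allLt (.len X) (allLe (.len X) (mem2 C ♯1 ♯0 →ᶠ
    (♯1 ∈ᶠ X →ᶠ mem2 C (♯1 +ᶠ .one) (♯0 +ᶠ .one)) ∧ᶠ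
    (¬ᶠ(♯1 ∈ᶠ X) →ᶠ mem2 C (♯1 +ᶠ .one) ♯0)))

/-! ## CSP instances -/

/-- The data of an instance `Θ = (𝒳, 𝒜)`: the number `n` of variables and the size `l` of the
universe; the input digraph `(VX, EX)`; the target digraph with domains `(V, E)`, whose domains are
`D_i = {a : V(i, a)}`.  The last four fields are set variables. -/
structure Inst where
  n : Term
  l : Term
  VX : ℕ
  EX : ℕ
  V : ℕ
  E : ℕ

namespace Inst

/-- Weakening by one number variable. -/
def up (Θ : Inst) : Inst := { Θ with n := Θ.n.up, l := Θ.l.up }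

/-- Weakening by one set variable. -/
def upS (Θ : Inst) : Inst :=
  { n := Θ.n.upS, l := Θ.l.upS, VX := Θ.VX + 1, EX := Θ.EX + 1, V := Θ.V + 1, E := Θ.E + 1 }

/-- The instance with the same input digraph and the target digraph `(V', E')`. -/
def withTarget (Θ : Inst) (V' E' : ℕ) : Inst := { Θ with V := V', E := E' }

/-- `D_i(a)` -/
def dom (Θ : Inst) (i a : Term) : Fml := mem2 Θ.V i a

/-- `E_𝒳(i, j)` -/
def edgeX (Θ : Inst) (i j : Term) : Fml := mem2 Θ.EX i j

/-- `E^{ij}(a, b)`, that is, `E(⟨i, a⟩, ⟨j, b⟩)`. -/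
def edge (Θ : Inst) (i j a b : Term) : Fml := memEdge Θ.E i a j b

/-- `V_𝒳 = {0, …, n - 1}` and `E_𝒳` is a binary relation on it. -/
def isInput (Θ : Inst) : Fml :=
  .len Θ.VX =ᶠ Θ.n ∧ᶠ allLt Θ.n (♯0 ∈ᶠ Θ.VX) ∧ᶠ
  allLt (.len Θ.EX) (♯0 ∈ᶠ Θ.EX →ᶠ
    exLt Θ.n.up (exLt Θ.n.up.up (isPair ♯1 ♯0 ♯2)))

/-- `V` is a set of pairs `⟨i, a⟩` with `i < n`, `a < l`, and every edge of `E` joins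
`⟨i, a⟩` with `⟨j, b⟩` for some `i, j < n`, `a ∈ D_i`, `b ∈ D_j`. -/
def isTarget (Θ : Inst) : Fml :=
  allLt (.len Θ.V) (♯0 ∈ᶠ Θ.V →ᶠ
    exLt Θ.n.up (exLt Θ.l.up.up (isPair ♯1 ♯0 ♯2))) ∧ᶠ
  allLt (.len Θ.E) (allLt (.len Θ.E) (mem2 Θ.E ♯1 ♯0 →ᶠ
    -- from here on: `5 = u`, `4 = v`, `3 = i`, `2 = j`, `1 = a`, `0 = b`
    exLt Θ.up.up.n (exLt Θ.up.up.up.n (exLt Θ.up.up.up.up.l (exLt Θ.up.up.up.up.up.l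
      (isPair ♯3 ♯1 ♯5 ∧ᶠ isPair ♯2 ♯0 ♯4 ∧ᶠ Θ.dom ♯3 ♯1 ∧ᶠ Θ.dom ♯2 ♯0))))))

/-- `Θ` is an instance. -/
def isInstance (Θ : Inst) : Fml := Θ.isInput ∧ᶠ Θ.isTarget

/-- The set `H` is a homomorphism from the input digraph to the target digraph with domains, where
`m = ⟨n, l⟩`. -/
def isHom (Θ : Inst) (m : Term) (H : ℕ) : Fml :=
  -- `H` is a well-defined map from `V_𝒳` to `V`
  allLt (.len Θ.VX) (♯0 ∈ᶠ Θ.VX →ᶠ exLt (.len Θ.V) (♯0 ∈ᶠ Θ.V ∧ᶠ mem2 H ♯1 ♯0)) ∧ᶠ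
  allLt (.len Θ.VX) (♯0 ∈ᶠ Θ.VX →ᶠ
    allLt (.len Θ.V) (♯0 ∈ᶠ Θ.V →ᶠ allLt (.len Θ.V) (♯0 ∈ᶠ Θ.V →ᶠ
      mem2 H ♯2 ♯1 ∧ᶠ mem2 H ♯2 ♯0 →ᶠ ♯1 =ᶠ ♯0))) ∧ᶠ
  -- it sends every variable `i` to its domain `D_i`
  allLt Θ.n (allLt m.up (mem2 H ♯1 ♯0 →ᶠ
    exLt Θ.up.up.l (isPair ♯2 ♯0 ♯1 ∧ᶠ Θ.dom ♯2 ♯0))) ∧ᶠ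
  -- it sends edges to edges (`3 = i₁`, `2 = i₂`, `1 = j₁`, `0 = j₂`)
  allLt Θ.n (allLt Θ.up.n (allLt m.up.up (allLt m.up.up.up
    (Θ.edgeX ♯3 ♯2 ∧ᶠ mem2 H ♯3 ♯1 ∧ᶠ mem2 H ♯2 ♯0 →ᶠ mem2 Θ.E ♯1 ♯0))))

/-- `Θ` has a solution: there is a homomorphism `H ≤ ⟨n, ⟨n, l⟩⟩`.  Here number variable
`1` is `⟨n, l⟩` and number variable `0` is `⟨n, ⟨n, l⟩⟩`. -/
def hasSolution (Θ : Inst) : Fml :=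
  exLe (pairBound Θ.n Θ.l) (exLe (pairBound Θ.up.n ♯0)
    (isPair Θ.up.up.n Θ.up.up.l ♯1 ∧ᶠ isPair Θ.up.up.n ♯1 ♯0 ∧ᶠ
      exSLe ♯0 (Θ.up.up.upS.isHom ♯1 0)))

/-! ## Cycle-consistency reduction -/

/-- `E^{ij}_{ℛ₀}(a, b)`: the full relation `D_i × D_j` intersected with all constraints on
`i, j`. -/
def edge0 (Θ : Inst) (i j a b : Term) : Fml :=
  (Θ.dom i a ∧ᶠ Θ.dom j b) ∧ᶠ
  (Θ.edgeX i j →ᶠ Θ.edge i j a b) ∧ᶠ (Θ.edgeX j i →ᶠ Θ.edge j i b a)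

/-- `Pr₁(i, a)`: the intersection of the projections of the relations `E^{ij}_{ℛ₀}` on the
variable `i`. -/
def pr1 (Θ : Inst) (i a : Term) : Fml :=
  Θ.dom i a ∧ᶠ
  allLt Θ.n (Θ.edgeX i.up ♯0 →ᶠ
    exLt Θ.up.l (Θ.dom ♯1 ♯0 ∧ᶠ Θ.up.up.edge0 i.up.up ♯1 a.up.up ♯0)) ∧ᶠ
  allLt Θ.n (Θ.edgeX ♯0 i.up →ᶠ
    exLt Θ.up.l (Θ.dom ♯1 ♯0 ∧ᶠ Θ.up.up.edge0 ♯1 i.up.up ♯0 a.up.up))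

/-- `∀ i < n, ∀ a < l, φ`, with `1 = i`, `0 = a` in `φ`. -/
def allVert (Θ : Inst) (φ : Fml) : Fml := allLt Θ.n (allLt Θ.up.l φ)

/-- `∀ i, j < n, ∀ a, b < l, φ`, with `3 = i`, `2 = j`, `1 = a`, `0 = b` in `φ`. -/
def allEdge (Θ : Inst) (φ : Fml) : Fml :=
  allLt Θ.n (allLt Θ.up.n (allLt Θ.up.up.l (allLt Θ.up.up.up.l φ)))

/-- `(V₁, E₁)` is the target digraph with domains `ℛ₁`. -/
def isR1 (Θ : Inst) (V₁ E₁ : ℕ) : Fml :=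
  (Θ.withTarget V₁ E₁).isTarget ∧ᶠ
  Θ.allVert (mem2 V₁ ♯1 ♯0 ↔ᶠ Θ.up.up.pr1 ♯1 ♯0) ∧ᶠ
  Θ.allEdge (memEdge E₁ ♯3 ♯1 ♯2 ♯0 ↔ᶠ
    Θ.up.up.up.up.pr1 ♯3 ♯1 ∧ᶠ Θ.up.up.up.up.pr1 ♯2 ♯0 ∧ᶠ
    Θ.up.up.up.up.edge0 ♯3 ♯2 ♯1 ♯0)

/-- `R` codes the propagation sequence `R₁, …, R_{q+1}`, with `R(t, i, j, a, b)` for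
`R_t(i, j, a, b)`: `R₁` is `E₁`, and
`R_{t+1}(i,j,a,b) ↔ R_t(i,j,a,b) ∧ ∀ k < n ∃ c < l (Pr₁(k,c) ∧ R_t(i,k,a,c) ∧ R_t(k,j,c,b))`
for `1 ≤ t ≤ q`. -/
def isPropagation (Θ : Inst) (E₁ R : ℕ) (q : Term) : Fml :=
  Θ.allEdge (mem5 R .one ♯3 ♯2 ♯1 ♯0 ↔ᶠ memEdge E₁ ♯3 ♯1 ♯2 ♯0) ∧ᶠ
  -- `4 = t`, `3 = i`, `2 = j`, `1 = a`, `0 = b`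
  allLe q (.one ≤ᶠ ♯0 →ᶠ Θ.up.allEdge
    (mem5 R (♯4 +ᶠ .one) ♯3 ♯2 ♯1 ♯0 ↔ᶠ
      mem5 R ♯4 ♯3 ♯2 ♯1 ♯0 ∧ᶠ
      -- `6 = t`, `5 = i`, `4 = j`, `3 = a`, `2 = b`, `1 = k`, `0 = c`
      allLt Θ.up.up.up.up.up.n (exLt Θ.up.up.up.up.up.up.l
        (Θ.up.up.up.up.up.up.up.pr1 ♯1 ♯0 ∧ᶠ
          mem5 R ♯6 ♯5 ♯1 ♯3 ♯0 ∧ᶠ mem5 R ♯6 ♯1 ♯4 ♯0 ♯2))))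

/-- `Pr_cc(i, a)`, where `R_t` is the last relation of the propagation sequence. -/
def prcc (Θ : Inst) (R : ℕ) (t i a : Term) : Fml :=
  Θ.pr1 i a ∧ᶠ
  allLt Θ.n (Θ.edgeX i.up ♯0 →ᶠ
    exLt Θ.up.l (Θ.up.up.pr1 ♯1 ♯0 ∧ᶠ mem5 R t.up.up i.up.up ♯1 a.up.up ♯0)) ∧ᶠ
  allLt Θ.n (Θ.edgeX ♯0 i.up →ᶠ
    exLt Θ.up.l (Θ.up.up.pr1 ♯1 ♯0 ∧ᶠ mem5 R t.up.up ♯1 i.up.up ♯0 a.up.up))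

/-- `(V', E')` is the target digraph with domains obtained from `Pr_cc` and `R_t`. -/
def isFinal (Θ : Inst) (R : ℕ) (t : Term) (V' E' : ℕ) : Fml :=
  (Θ.withTarget V' E').isTarget ∧ᶠ
  Θ.allVert (mem2 V' ♯1 ♯0 ↔ᶠ Θ.up.up.prcc R t.up.up ♯1 ♯0) ∧ᶠ
  Θ.allEdge (memEdge E' ♯3 ♯1 ♯2 ♯0 ↔ᶠ
    (Θ.up.up.up.up.prcc R t.up.up.up.up ♯3 ♯1 ∧ᶠ Θ.up.up.up.up.prcc R t.up.up.up.up ♯2 ♯0) ∧ᶠ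
    mem5 R t.up.up.up.up ♯3 ♯2 ♯1 ♯0)

/-- `(V', E')` is `𝒜_cc`: there are `ℛ₁ = (V₁, E₁)`, the census function `C` of `E₁`, the number
`q` of edges of `ℛ₁`, and the propagation sequence `R = (R₁, …, R_{q+1})`, from which it is
obtained.  The set variables bound here are `3 = V₁`, `2 = E₁`, `1 = C`, `0 = R`, the number
variable is `0 = q`. -/
def isCC (Θ : Inst) (V' E' : ℕ) : Fml :=
  .exS (.exS (.exS (.exS
    (Θ.upS.upS.upS.upS.isR1 3 2 ∧ᶠ census 2 1 ∧ᶠ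
      exLe (.len 2) (mem2 1 (.len 2) ♯0 ∧ᶠ
        Θ.upS.upS.upS.upS.up.isPropagation 2 0 ♯0 ∧ᶠ
        Θ.upS.upS.upS.upS.up.isFinal 0 (♯0 +ᶠ .one) (V' + 4) (E' + 4))))))

end Inst

/-- For every instance `Θ` the instance `Θ_cc` exists, and `Θ` has a solution if and only if
`Θ_cc` has one.  The outer variables are `n, l` (numbers `1, 0`) and `V_𝒳, E_𝒳, V, E`
(sets `3, 2, 1, 0`); inside, the target of `Θ_cc` is given by the set variables `1, 0`. -/
def ccSoundness : Fml :=
  let Θ : Inst := ⟨♯1, ♯0, 3, 2, 1, 0⟩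
  let Θ' : Inst := Θ.upS.upS
  .allN (.allN (.allS (.allS (.allS (.allS (Θ.isInstance →ᶠ
    .exS (.exS (Θ'.isCC 1 0)) ∧ᶠ
    .allS (.allS (Θ'.isCC 1 0 →ᶠ
      (Θ'.hasSolution ↔ᶠ (Θ'.withTarget 1 0).hasSolution)))))))))

end BA

-- Derivability in the calculus is obtained from truth in all models. The completeness theorem
-- `proves_of_forall_model` is proved by Henkin's method. Hypotheses form finite lists, so fresh
-- variables can serve as witnesses and no new constants are needed. The model consists of number
-- terms and set variables modulo provable equality. It remains to argue inside an arbitrary,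
-- possibly nonstandard, model of $V^1$.
--
-- In such a model the numbers form a linearly ordered commutative semiring with Cantor pairing.
-- Anything $\Sigma^{1,b}_0$-definable below a bound is a set, and $\Sigma^{1,b}_1$ number induction
-- holds.
--
-- Existence of $\Theta_{cc}$. The digraph $\mathcal R_1$ and the final target are
-- $\Sigma^{1,b}_0$-definable from sets already at hand, so comprehension gives them
-- (`exists_target`). The census function and the sequence $R_1,\dots,R_{q+1}$ are defined by
-- recursion. They come from $\Sigma^{1,b}_1$ induction on the statement that a set of length at
-- most a fixed bound codes the first stages; comprehension extends the code by one stage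
-- (`exists_isCensus_succ`, `exists_isPropagation_succ`).
--
-- Equivalence. One and the same set $H$ solves both instances. If $H$ solves $\Theta$, the pairs of
-- its values lie in every $R_t$: in the recursion the witness $c$ at $k$ is the value of $H$ at
-- $k$. This is a $\Sigma^{1,b}_0$ induction with parameters $H$ and $R$ (`IsHom.mem_propagation`).
-- Conversely the relations decrease (`IsPropagation.mem_one`), so edges of the reduced target lie
-- in $R_1\subseteq E_0$, and the reduced domains lie in the original ones.

namespace BA

/-! ## Substitution calculus -/

/-- Prepend a value to a sequence of values of variables. -/
def scons {α : Type*} (a : α) (f : ℕ → α) : ℕ → α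
  | 0 => a
  | k + 1 => f k

@[simp] theorem scons_zero {α : Type*} (a : α) (f : ℕ → α) : scons a f 0 = a := rfl
@[simp] theorem scons_succ {α : Type*} (a : α) (f : ℕ → α) (k : ℕ) :
    scons a f (k + 1) = f k := rfl

theorem scons_comp {α β : Type*} (g : α → β) (a : α) (f : ℕ → α) :
    (fun k => g (scons a f k)) = scons (g a) (fun k => g (f k)) := by
  funext k; cases k <;> rfl

theorem Term.subst_subst (σ σ' : ℕ → Term) (ρ ρ' : ℕ → ℕ) (t : Term) :
    (t.subst σ ρ).subst σ' ρ' = t.subst (fun k => (σ k).subst σ' ρ') (fun X => ρ' (ρ X)) := by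
  induction t <;> simp_all [Term.subst]

theorem Term.subst_id (t : Term) : t.subst Term.var id = t := by
  induction t <;> simp_all [Term.subst]

theorem Term.up_subst_liftN (σ : ℕ → Term) (ρ : ℕ → ℕ) (t : Term) :
    t.up.subst (liftN σ) ρ = (t.subst σ ρ).up := by
  simp only [Term.up, Term.subst_subst]; rfl

theorem Term.upS_subst_liftS (σ : ℕ → Term) (ρ : ℕ → ℕ) (t : Term) :
    t.upS.subst (fun k => (σ k).upS) (liftS ρ) = (t.subst σ ρ).upS := by
  simp only [Term.upS, Term.subst_subst]; rfl

theorem Term.up_subst_consN (t s : Term) : t.up.subst (consN s) id = t := by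
  simp only [Term.up, Term.subst_subst]; exact t.subst_id

theorem Term.upS_subst_consS (t : Term) (Y : ℕ) : t.upS.subst Term.var (consS Y) = t := by
  simp only [Term.upS, Term.subst_subst]; exact t.subst_id

theorem liftN_var : liftN Term.var = Term.var := by
  funext k; cases k <;> rfl

theorem liftS_id : liftS id = id := by
  funext k; cases k <;> rfl

theorem Fml.subst_id (φ : Fml) : φ.subst Term.var id = φ := by
  induction φ with
  | allN φ ih => simp [Fml.subst, liftN_var, ih]
  | allS φ ih =>
    have : (fun k => (Term.var k).upS) = Term.var := rfl
    simp [Fml.subst, liftS_id, ih, this]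
  | _ => simp_all [Fml.subst, Term.subst_id]

theorem Fml.subst_subst (φ : Fml) : ∀ (σ σ' : ℕ → Term) (ρ ρ' : ℕ → ℕ),
    (φ.subst σ ρ).subst σ' ρ' = φ.subst (fun k => (σ k).subst σ' ρ') (fun X => ρ' (ρ X)) := by
  induction φ with
  | allN φ ih =>
    intro σ σ' ρ ρ'
    simp only [Fml.subst, ih]
    congr 2
    funext k
    cases k with
    | zero => rfl
    | succ k => exact Term.up_subst_liftN _ _ _
  | allS φ ih =>
    intro σ σ' ρ ρ'
    simp only [Fml.subst, ih]
    congr 2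
    · funext k; exact Term.upS_subst_liftS _ _ _
    · funext k; cases k <;> rfl
  | _ => simp_all [Fml.subst, Term.subst_subst]

theorem Fml.instN_subst (φ : Fml) (t : Term) (σ : ℕ → Term) (ρ : ℕ → ℕ) :
    (φ.instN t).subst σ ρ = (φ.subst (liftN σ) ρ).instN (t.subst σ ρ) := by
  simp only [Fml.instN, Fml.subst_subst]
  congr 1
  funext k
  cases k with
  | zero => rfl
  | succ k => exact (Term.up_subst_consN _ _).symm

theorem Fml.instS_subst (φ : Fml) (Y : ℕ) (σ : ℕ → Term) (ρ : ℕ → ℕ) :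
    (φ.instS Y).subst σ ρ = (φ.subst (fun k => (σ k).upS) (liftS ρ)).instS (ρ Y) := by
  simp only [Fml.instS, Fml.subst_subst]
  congr 1
  · funext k; exact (Term.upS_subst_consS _ _).symm
  · funext k; cases k <;> rfl

theorem Fml.subst_liftN_instN (φ : Fml) (t : Term) (σ : ℕ → Term) (ρ : ℕ → ℕ) :
    (φ.subst (liftN σ) ρ).instN t = φ.subst (scons t σ) ρ := by
  simp only [Fml.instN, Fml.subst_subst]
  congr 1
  funext k
  cases k with
  | zero => rfl
  | succ k => exact Term.up_subst_consN _ _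

theorem Fml.subst_liftS_instS (φ : Fml) (Y : ℕ) (σ : ℕ → Term) (ρ : ℕ → ℕ) :
    (φ.subst (fun k => (σ k).upS) (liftS ρ)).instS Y = φ.subst σ (scons Y ρ) := by
  simp only [Fml.instS, Fml.subst_subst]
  congr 1
  · funext k; exact Term.upS_subst_consS _ _
  · funext k; cases k <;> rfl

theorem Fml.up_subst_liftN (φ : Fml) (σ : ℕ → Term) (ρ : ℕ → ℕ) :
    φ.up.subst (liftN σ) ρ = (φ.subst σ ρ).up := by
  simp only [Fml.up, Fml.subst_subst]; rfl

theorem Fml.upS_subst_liftS (φ : Fml) (σ : ℕ → Term) (ρ : ℕ → ℕ) :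
    φ.upS.subst (fun k => (σ k).upS) (liftS ρ) = (φ.subst σ ρ).upS := by
  simp only [Fml.upS, Fml.subst_subst]; rfl

/-- Finiteness of the set of free variables is expressed through agreement of substitutions, which
is the form used to choose fresh variables and to truncate substitutions. -/
theorem Term.exists_bound (t : Term) : ∃ b, ∀ (σ σ' : ℕ → Term) (ρ ρ' : ℕ → ℕ),
    (∀ k < b, σ k = σ' k) → (∀ k < b, ρ k = ρ' k) → t.subst σ ρ = t.subst σ' ρ' := by
  induction t with
  | var k => exact ⟨k + 1, fun _ _ _ _ h _ => h k k.lt_succ_self⟩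
  | len X => exact ⟨X + 1, fun _ _ _ _ _ h => congrArg Term.len (h X X.lt_succ_self)⟩
  | zero => exact ⟨0, fun _ _ _ _ _ _ => rfl⟩
  | one => exact ⟨0, fun _ _ _ _ _ _ => rfl⟩
  | add s t hs ht | mul s t hs ht =>
    obtain ⟨b, hb⟩ := hs
    obtain ⟨c, hc⟩ := ht
    refine ⟨max b c, fun σ σ' ρ ρ' h h' => ?_⟩
    simp only [Term.subst]
    rw [hb σ σ' ρ ρ' (fun k hk => h k (lt_max_of_lt_left hk))
        (fun k hk => h' k (lt_max_of_lt_left hk)),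
      hc σ σ' ρ ρ' (fun k hk => h k (lt_max_of_lt_right hk))
        (fun k hk => h' k (lt_max_of_lt_right hk))]

/-- Only finitely many variables are free in a formula. -/
theorem Fml.exists_bound (φ : Fml) : ∃ b, ∀ (σ σ' : ℕ → Term) (ρ ρ' : ℕ → ℕ),
    (∀ k < b, σ k = σ' k) → (∀ k < b, ρ k = ρ' k) → φ.subst σ ρ = φ.subst σ' ρ' := by
  induction φ with
  | falsum => exact ⟨0, fun _ _ _ _ _ _ => rfl⟩
  | eqS X Y =>
    refine ⟨max X Y + 1, fun σ σ' ρ ρ' _ h => ?_⟩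
    simp only [Fml.subst]
    rw [h X (by omega), h Y (by omega)]
  | mem t X =>
    obtain ⟨b, hb⟩ := t.exists_bound
    refine ⟨max b (X + 1), fun σ σ' ρ ρ' h h' => ?_⟩
    simp only [Fml.subst]
    rw [h' X (by omega), hb σ σ' ρ ρ' (fun k hk => h k (by omega)) (fun k hk => h' k (by omega))]
  | eqN s t | le s t =>
    obtain ⟨b, hb⟩ := s.exists_bound
    obtain ⟨c, hc⟩ := t.exists_bound
    refine ⟨max b c, fun σ σ' ρ ρ' h h' => ?_⟩
    simp only [Fml.subst]
    rw [hb σ σ' ρ ρ' (fun k hk => h k (by omega)) (fun k hk => h' k (by omega)),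
      hc σ σ' ρ ρ' (fun k hk => h k (by omega)) (fun k hk => h' k (by omega))]
  | imp s t hs ht =>
    obtain ⟨b, hb⟩ := hs
    obtain ⟨c, hc⟩ := ht
    refine ⟨max b c, fun σ σ' ρ ρ' h h' => ?_⟩
    simp only [Fml.subst]
    rw [hb σ σ' ρ ρ' (fun k hk => h k (by omega)) (fun k hk => h' k (by omega)),
      hc σ σ' ρ ρ' (fun k hk => h k (by omega)) (fun k hk => h' k (by omega))]
  | allN φ ih =>
    obtain ⟨b, hb⟩ := ih
    refine ⟨b, fun σ σ' ρ ρ' h h' => ?_⟩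
    simp only [Fml.subst]
    rw [hb (liftN σ) (liftN σ') ρ ρ' ?_ h']
    rintro (_ | k) hk
    · rfl
    · simp only [liftN]; rw [h k (by omega)]
  | allS φ ih =>
    obtain ⟨b, hb⟩ := ih
    refine ⟨b, fun σ σ' ρ ρ' h h' => ?_⟩
    simp only [Fml.subst]
    rw [hb _ (fun k => (σ' k).upS) (liftS ρ) (liftS ρ') (fun k hk => by rw [h k hk]) ?_]
    rintro (_ | k) hk
    · rfl
    · simp only [liftS]; rw [h' k (by omega)]

/-! ## Derivability under substitution and weakening -/

variable {T : Set Fml}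

theorem Proves.weaken {Γ : List Fml} {φ : Fml} (h : Proves T Γ φ) :
    ∀ {Δ : List Fml}, Γ ⊆ Δ → Proves T Δ φ := by
  induction h with
  | ax h => exact fun _ => .ax h
  | hyp h => exact fun hs => .hyp (hs h)
  | impI _ ih => exact fun hs => .impI (ih (List.cons_subset_cons _ hs))
  | impE _ _ ih₁ ih₂ => exact fun hs => .impE (ih₁ hs) (ih₂ hs)
  | raa _ ih => exact fun hs => .raa (ih (List.cons_subset_cons _ hs))
  | allNI _ ih => exact fun hs => .allNI (ih (List.map_subset _ hs))
  | allNE t _ ih => exact fun hs => .allNE t (ih hs)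
  | allSI _ ih => exact fun hs => .allSI (ih (List.map_subset _ hs))
  | allSE t _ ih => exact fun hs => .allSE t (ih hs)
  | eqNRefl t => exact fun _ => .eqNRefl t
  | eqNSubst φ _ _ ih₁ ih₂ => exact fun hs => .eqNSubst φ (ih₁ hs) (ih₂ hs)
  | eqSRefl t => exact fun _ => .eqSRefl t
  | eqSSubst φ _ _ ih₁ ih₂ => exact fun hs => .eqSSubst φ (ih₁ hs) (ih₂ hs)

/-- Generalizing `k` times and then instantiating `k` times is a simultaneous substitution for the
first `k` variables that shifts all others down by `k`; hence the condition on `σ`. Derivability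
from every `Γ` is assumed because each generalization weakens the context. -/
theorem proves_subst_number (k : ℕ) : ∀ {φ : Fml},
    (∀ Γ, Proves T Γ φ) → ∀ σ : ℕ → Term, (∀ j, σ (j + k) = ♯j) →
      ∀ Γ, Proves T Γ (φ.subst σ id) := by
  induction k with
  | zero =>
    intro φ h σ hσ Γ
    obtain rfl : σ = Term.var := funext hσ
    rw [Fml.subst_id]; exact h Γ
  | succ k ih =>
    intro φ h σ hσ Γ
    have := (ih (φ := .allN φ) (fun Γ => .allNI (h _)) (fun j => σ (j + 1))
      (fun j => hσ j) Γ).allNE (σ 0)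
    rw [Fml.subst_liftN_instN] at this
    convert this using 2
    funext j; cases j <;> rfl

theorem proves_subst_set (k : ℕ) : ∀ {φ : Fml},
    (∀ Γ, Proves T Γ φ) → ∀ ρ : ℕ → ℕ, (∀ j, ρ (j + k) = j) →
      ∀ Γ, Proves T Γ (φ.subst Term.var ρ) := by
  induction k with
  | zero =>
    intro φ h ρ hρ Γ
    obtain rfl : ρ = id := funext hρ
    rw [Fml.subst_id]; exact h Γ
  | succ k ih =>
    intro φ h ρ hρ Γ
    have := (ih (φ := .allS φ) (fun Γ => .allSI (h _)) (fun j => ρ (j + 1))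
      (fun j => hρ j) Γ).allSE (ρ 0)
    rw [Fml.subst_liftS_instS] at this
    convert this using 2
    funext j; cases j <;> rfl

/-- A formula that is derivable from all contexts may be substituted into. -/
theorem proves_subst_of_forall {φ : Fml} (h : ∀ Γ, Proves T Γ φ) (σ : ℕ → Term) (ρ : ℕ → ℕ)
    (Γ : List Fml) : Proves T Γ (φ.subst σ ρ) := by
  obtain ⟨b, hb⟩ := φ.exists_bound
  -- Values at indices from `b` on do not affect `φ`, so `ρ` may be replaced there by the shift that
  -- `proves_subst_set` demands; the same is then done for numbers with `c`.
  have h₁ := proves_subst_set b h (fun j => if j < b then ρ j else j - b) (fun j => by simp)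
  obtain ⟨c, hc⟩ := (φ.subst Term.var (fun j => if j < b then ρ j else j - b)).exists_bound
  have h₂ := proves_subst_number c h₁ (fun j => if j < c then σ j else ♯(j - c))
    (fun j => by simp) Γ
  rw [hc _ σ _ id (fun k hk => by simp [hk]) (fun _ _ => rfl), Fml.subst_subst] at h₂
  convert h₂ using 1
  exact hb _ _ _ _ (fun k _ => rfl) (fun k hk => by simp [hk])

/-- Since `T` need not be closed under substitution, the axiom case rests on
`proves_subst_of_forall`; the quantifier rules commute with substitution by the lifting identities.
-/
theorem Proves.subst {Γ : List Fml} {φ : Fml} (h : Proves T Γ φ) :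
    ∀ (σ : ℕ → Term) (ρ : ℕ → ℕ), Proves T (Γ.map (Fml.subst σ ρ)) (φ.subst σ ρ) := by
  induction h with
  | ax h => exact fun σ ρ => proves_subst_of_forall (fun _ => .ax h) σ ρ _
  | hyp h => exact fun σ ρ => .hyp (List.mem_map_of_mem h)
  | impI _ ih => exact fun σ ρ => .impI (ih σ ρ)
  | impE _ _ ih₁ ih₂ => exact fun σ ρ => .impE (ih₁ σ ρ) (ih₂ σ ρ)
  | raa _ ih => exact fun σ ρ => .raa (ih σ ρ)
  | allNI _ ih =>
    intro σ ρ
    refine .allNI ?_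
    have := ih (liftN σ) ρ
    simpa only [List.map_map, Function.comp_def, Fml.up_subst_liftN] using this
  | allNE t _ ih =>
    intro σ ρ
    rw [Fml.instN_subst]
    exact .allNE _ (ih σ ρ)
  | allSI _ ih =>
    intro σ ρ
    refine .allSI ?_
    have := ih (fun k => (σ k).upS) (liftS ρ)
    simpa only [List.map_map, Function.comp_def, Fml.upS_subst_liftS] using this
  | allSE t _ ih =>
    intro σ ρ
    rw [Fml.instS_subst]
    exact .allSE _ (ih σ ρ)
  | eqNRefl t => exact fun _ _ => .eqNRefl _
  | eqNSubst φ _ _ ih₁ ih₂ =>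
    intro σ ρ
    have h₁ := ih₁ σ ρ
    have h₂ := ih₂ σ ρ
    rw [Fml.instN_subst] at h₂ ⊢
    exact .eqNSubst _ h₁ h₂
  | eqSRefl t => exact fun _ _ => .eqSRefl _
  | eqSSubst φ _ _ ih₁ ih₂ =>
    intro σ ρ
    have h₁ := ih₁ σ ρ
    have h₂ := ih₂ σ ρ
    rw [Fml.instS_subst] at h₂ ⊢
    exact .eqSSubst _ h₁ h₂

theorem exists_bound_list (Γ : List Fml) : ∃ b, ∀ φ ∈ Γ, ∀ (σ σ' : ℕ → Term) (ρ ρ' : ℕ → ℕ),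
    (∀ k < b, σ k = σ' k) → (∀ k < b, ρ k = ρ' k) → φ.subst σ ρ = φ.subst σ' ρ' := by
  induction Γ with
  | nil => exact ⟨0, by simp⟩
  | cons φ Γ ih =>
    obtain ⟨b, hb⟩ := ih
    obtain ⟨c, hc⟩ := φ.exists_bound
    refine ⟨max b c, ?_⟩
    simp only [List.mem_cons, forall_eq_or_imp]
    exact ⟨fun σ σ' ρ ρ' h h' => hc _ _ _ _ (fun k hk => h k (by omega))
        (fun k hk => h' k (by omega)),
      fun ψ hψ σ σ' ρ ρ' h h' => hb ψ hψ _ _ _ _ (fun k hk => h k (by omega))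
        (fun k hk => h' k (by omega))⟩

/-- Generalization over a fresh number variable. -/
theorem exists_fresh_number (Γ : List Fml) (φ : Fml) :
    ∃ c : ℕ, Proves T Γ (φ.instN ♯c) → Proves T Γ (.allN φ) := by
  obtain ⟨c, hc⟩ := exists_bound_list (φ :: Γ)
  simp only [List.mem_cons, forall_eq_or_imp] at hc
  refine ⟨c, fun h => .allNI ?_⟩
  -- This sends the fresh variable to the variable about to be bound and shifts the rest up: `Γ`
  -- becomes its weakening, and the instance of `φ` at `c` becomes `φ`.
  have := h.subst (fun k => if k = c then ♯0 else ♯(k + 1)) id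
  rw [Fml.instN, Fml.subst_subst] at this
  convert this using 1
  · refine List.map_congr_left fun ψ hψ => hc.2 ψ hψ _ _ _ _ (fun k hk => ?_) (fun _ _ => rfl)
    simp [hk.ne]
  · refine φ.subst_id.symm.trans (hc.1 _ _ _ _ ?_ (fun _ _ => rfl))
    rintro (_ | k) hk
    · simp [consN, Term.subst]
    · have : k ≠ c := by omega
      simp [consN, Term.subst, this]

/-- Generalization over a fresh set variable. -/
theorem exists_fresh_set (Γ : List Fml) (φ : Fml) :
    ∃ c : ℕ, Proves T Γ (φ.instS c) → Proves T Γ (.allS φ) := by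
  obtain ⟨c, hc⟩ := exists_bound_list (φ :: Γ)
  simp only [List.mem_cons, forall_eq_or_imp] at hc
  refine ⟨c, fun h => .allSI ?_⟩
  have := h.subst Term.var (fun k => if k = c then 0 else k + 1)
  rw [Fml.instS, Fml.subst_subst] at this
  convert this using 1
  · refine List.map_congr_left fun ψ hψ => hc.2 ψ hψ _ _ _ _ (fun _ _ => rfl) (fun k hk => ?_)
    simp [hk.ne]
  · refine φ.subst_id.symm.trans (hc.1 _ _ _ _ (fun _ _ => rfl) ?_)
    rintro (_ | k) hk
    · simp [consS]
    · have : k ≠ c := by omega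
      simp [consS, this]

end BA

namespace BA

/-! ## Structures and satisfaction -/

/-- Two-sorted structures for the vocabulary, with nonempty set sort. -/
structure Str where
  N : Type
  S : Type
  zero : N
  one : N
  add : N → N → N
  mul : N → N → N
  le : N → N → Prop
  len : S → N
  mem : N → S → Prop
  setDefault : S

namespace Str

variable (M : Str)

def val (e : ℕ → M.N) (s : ℕ → M.S) : Term → M.N
  | .var k => e k
  | .zero => M.zero
  | .one => M.one
  | .add a b => M.add (val e s a) (val e s b)
  | .mul a b => M.mul (val e s a) (val e s b)
  | .len X => M.len (s X)

def Sat : (ℕ → M.N) → (ℕ → M.S) → Fml → Prop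
  | _, _, .falsum => False
  | e, s, .eqN a b => M.val e s a = M.val e s b
  | _, s, .eqS X Y => s X = s Y
  | e, s, .le a b => M.le (M.val e s a) (M.val e s b)
  | e, s, .mem a X => M.mem (M.val e s a) (s X)
  | e, s, .imp φ ψ => Sat e s φ → Sat e s ψ
  | e, s, .allN φ => ∀ x : M.N, Sat (scons x e) s φ
  | e, s, .allS φ => ∀ X : M.S, Sat e (scons X s) φ

end Str

/-! ## Enumeration of formulas -/

def Term.code : Term → ℕ
  | .var k => Nat.pair 0 k
  | .zero => Nat.pair 1 0
  | .one => Nat.pair 2 0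
  | .add s t => Nat.pair 3 (Nat.pair s.code t.code)
  | .mul s t => Nat.pair 4 (Nat.pair s.code t.code)
  | .len X => Nat.pair 5 X

theorem Term.code_injective : Function.Injective Term.code := by
  intro s
  induction s with
  | add a b ha hb | mul a b ha hb =>
    intro t h
    cases t <;> simp [Term.code, Nat.pair_eq_pair] at h
    rw [ha h.1, hb h.2]
  | _ =>
    intro t h
    cases t <;> simp_all [Term.code, Nat.pair_eq_pair]

def Fml.code : Fml → ℕ
  | .falsum => Nat.pair 0 0
  | .eqN s t => Nat.pair 1 (Nat.pair s.code t.code)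
  | .eqS X Y => Nat.pair 2 (Nat.pair X Y)
  | .le s t => Nat.pair 3 (Nat.pair s.code t.code)
  | .mem t X => Nat.pair 4 (Nat.pair t.code X)
  | .imp φ ψ => Nat.pair 5 (Nat.pair φ.code ψ.code)
  | .allN φ => Nat.pair 6 φ.code
  | .allS φ => Nat.pair 7 φ.code

theorem Fml.code_injective : Function.Injective Fml.code := by
  intro φ
  induction φ with
  | imp a b ha hb =>
    intro t h
    cases t <;> simp [Fml.code, Nat.pair_eq_pair] at h
    rw [ha h.1, hb h.2]
  | allN a ha | allS a ha =>
    intro t h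
    cases t <;> simp [Fml.code, Nat.pair_eq_pair] at h
    rw [ha h]
  | _ =>
    intro t h
    cases t <;> simp_all [Fml.code, Nat.pair_eq_pair, Term.code_injective.eq_iff]

instance : Countable Fml := Fml.code_injective.countable
instance : Nonempty Fml := ⟨.falsum⟩

/-! ## Complete Henkin theories -/

variable {T : Set Fml}

theorem Proves.falsumE {Γ : List Fml} {φ : Fml} (h : Proves T Γ .falsum) : Proves T Γ φ :=
  .raa (h.weaken (List.subset_cons_self _ _))

/-- If `φ` is inconsistent with `Γ`, its negation already follows. Otherwise `φ` is added, and for a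
negated universal formula also a counterexample at a fresh variable. Were that inconsistent, the
instance would be derivable by contradiction, hence by freshness the universal formula, against the
consistency of `φ`. -/
theorem exists_henkin_step (Γ : List Fml) (hΓ : ¬ Proves T Γ .falsum) (φ : Fml) :
    ∃ Δ : List Fml, ¬ Proves T Δ .falsum ∧ Γ ⊆ Δ ∧ (Proves T Δ φ ∨ Proves T Δ ¬ᶠφ) ∧
      (∀ ψ, φ = ¬ᶠ(Fml.allN ψ) → Proves T Δ φ → ∃ t, Proves T Δ ¬ᶠ(ψ.instN t)) ∧
      (∀ ψ, φ = ¬ᶠ(Fml.allS ψ) → Proves T Δ φ → ∃ Y, Proves T Δ ¬ᶠ(ψ.instS Y)) := by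
  by_cases h : Proves T (φ :: Γ) .falsum
  · have hn : Proves T Γ ¬ᶠφ := .impI h
    have hφ : ¬ Proves T Γ φ := fun h' => hΓ (.impE hn h')
    exact ⟨Γ, hΓ, List.Subset.refl _, .inr hn, fun ψ _ h' => (hφ h').elim,
      fun ψ _ h' => (hφ h').elim⟩
  · have hmem : ∀ {Δ : List Fml}, Proves T (φ :: Δ) φ := .hyp (List.mem_cons_self ..)
    by_cases hN : ∃ ψ, φ = ¬ᶠ(Fml.allN ψ)
    · obtain ⟨ψ, rfl⟩ := hN
      obtain ⟨c, hc⟩ := exists_fresh_number (T := T) (¬ᶠ(Fml.allN ψ) :: Γ) ψ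
      refine ⟨¬ᶠ(ψ.instN ♯c) :: ¬ᶠ(Fml.allN ψ) :: Γ, fun hf => h ?_, ?_, .inl ?_, ?_, ?_⟩
      · exact .impE (.hyp (List.mem_cons_self ..)) (hc (.raa hf))
      · exact List.Subset.trans (List.subset_cons_self _ _) (List.subset_cons_self _ _)
      · exact .hyp (by simp)
      · rintro ψ' h' -
        simp only [Fml.neg, Fml.imp.injEq, Fml.allN.injEq, and_true] at h'
        subst h'
        exact ⟨♯c, .hyp (List.mem_cons_self ..)⟩
      · intro ψ' h'
        simp [Fml.neg] at h'
    by_cases hS : ∃ ψ, φ = ¬ᶠ(Fml.allS ψ)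
    · obtain ⟨ψ, rfl⟩ := hS
      obtain ⟨c, hc⟩ := exists_fresh_set (T := T) (¬ᶠ(Fml.allS ψ) :: Γ) ψ
      refine ⟨¬ᶠ(ψ.instS c) :: ¬ᶠ(Fml.allS ψ) :: Γ, fun hf => h ?_, ?_, .inl ?_, ?_, ?_⟩
      · exact .impE (.hyp (List.mem_cons_self ..)) (hc (.raa hf))
      · exact List.Subset.trans (List.subset_cons_self _ _) (List.subset_cons_self _ _)
      · exact .hyp (by simp)
      · intro ψ' h'
        simp [Fml.neg] at h'
      · rintro ψ' h' -
        simp only [Fml.neg, Fml.imp.injEq, Fml.allS.injEq, and_true] at h'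
        subst h'
        exact ⟨c, .hyp (List.mem_cons_self ..)⟩
    · exact ⟨φ :: Γ, h, List.subset_cons_self _ _, .inl hmem, fun ψ h' => (hN ⟨ψ, h'⟩).elim,
        fun ψ h' => (hS ⟨ψ, h'⟩).elim⟩

/-- `H` is a complete consistent deductively closed extension of `T` with Henkin witnesses. -/
structure IsHenkin (T : Set Fml) (H : Fml → Prop) : Prop where
  closed : ∀ {Γ φ}, (∀ ψ ∈ Γ, H ψ) → Proves T Γ φ → H φ
  consistent : ¬ H .falsum
  complete : ∀ φ, H φ ∨ H ¬ᶠφ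
  witnessN : ∀ ψ, H ¬ᶠ(Fml.allN ψ) → ∃ t, H ¬ᶠ(ψ.instN t)
  witnessS : ∀ ψ, H ¬ᶠ(Fml.allS ψ) → ∃ Y, H ¬ᶠ(ψ.instS Y)

theorem Proves.of_forall {Γ Δ : List Fml} {φ : Fml} (h : Proves T Γ φ) :
    (∀ ψ ∈ Γ, Proves T Δ ψ) → Proves T Δ φ := by
  induction Γ generalizing φ with
  | nil => exact fun _ => h.weaken (by simp)
  | cons ψ Γ ih =>
    intro hΔ
    exact .impE (ih (.impI h) fun χ hχ => hΔ χ (List.mem_cons_of_mem _ hχ))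
      (hΔ ψ (List.mem_cons_self ..))

/-- The theory is the union of the consequences of an increasing chain of finite contexts, one stage
per formula of an enumeration. Finitely many members are consequences of a common stage, which gives
deductive closure and consistency. -/
theorem exists_isHenkin (Γ₀ : List Fml) (h₀ : ¬ Proves T Γ₀ .falsum) :
    ∃ H, IsHenkin T H ∧ ∀ φ ∈ Γ₀, H φ := by
  obtain ⟨f, hf⟩ := exists_surjective_nat Fml
  choose next hcon hsub hdec hN hS using exists_henkin_step (T := T)
  let g : ℕ → {Γ : List Fml // ¬ Proves T Γ .falsum} := fun n =>
    Nat.rec ⟨Γ₀, h₀⟩ (fun n Γ => ⟨next Γ.1 Γ.2 (f n), hcon _ _ _⟩) n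
  have hg : ∀ n, (g (n + 1)).1 = next (g n).1 (g n).2 (f n) := fun n => rfl
  have hmono : ∀ m n, m ≤ n → (g m).1 ⊆ (g n).1 := by
    intro m n h
    induction h with
    | refl => exact List.Subset.refl _
    | step _ ih => exact List.Subset.trans ih (hsub _ _ _)
  have hfin : ∀ Γ : List Fml, (∀ ψ ∈ Γ, ∃ n, Proves T (g n).1 ψ) →
      ∃ n, ∀ ψ ∈ Γ, Proves T (g n).1 ψ := by
    intro Γ
    induction Γ with
    | nil => exact fun _ => ⟨0, by simp⟩
    | cons ψ Γ ih =>
      intro h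
      obtain ⟨n, hn⟩ := ih fun χ hχ => h χ (List.mem_cons_of_mem _ hχ)
      obtain ⟨m, hm⟩ := h ψ (List.mem_cons_self ..)
      refine ⟨max n m, ?_⟩
      simp only [List.mem_cons, forall_eq_or_imp]
      exact ⟨hm.weaken (hmono _ _ (le_max_right _ _)),
        fun χ hχ => (hn χ hχ).weaken (hmono _ _ (le_max_left _ _))⟩
  have hclosed : ∀ {Γ φ}, (∀ ψ ∈ Γ, ∃ n, Proves T (g n).1 ψ) → Proves T Γ φ →
      ∃ n, Proves T (g n).1 φ := by
    intro Γ φ h hφ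
    obtain ⟨n, hn⟩ := hfin Γ h
    exact ⟨n, hφ.of_forall hn⟩
  have hcons : ¬ ∃ n, Proves T (g n).1 .falsum := fun ⟨n, hn⟩ => (g n).2 hn
  -- A formula derivable at some stage was accepted at its own stage, since otherwise two stages
  -- would contradict each other. Thus its witness was added as well.
  have hat : ∀ n, (∃ m, Proves T (g m).1 (f n)) → Proves T (g (n + 1)).1 (f n) := by
    rintro n h
    rcases hdec (g n).1 (g n).2 (f n) with h' | h'
    · exact h'
    · refine (hcons (hclosed (Γ := [¬ᶠ(f n), f n]) ?_
        (.impE (φ := f n) (.hyp (by simp [Fml.neg])) (.hyp (by simp))))).elim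
      simp only [List.mem_cons, List.not_mem_nil, or_false, forall_eq_or_imp, forall_eq]
      exact ⟨⟨n + 1, h'⟩, h⟩
  refine ⟨fun φ => ∃ n, Proves T (g n).1 φ, ⟨hclosed, hcons, ?_, ?_, ?_⟩, ?_⟩
  · intro φ
    obtain ⟨n, rfl⟩ := hf φ
    exact (hdec (g n).1 (g n).2 (f n)).imp (fun h => ⟨n + 1, h⟩) fun h => ⟨n + 1, h⟩
  · intro ψ h
    obtain ⟨n, hn⟩ := hf (¬ᶠ(Fml.allN ψ))
    rw [← hn] at h
    obtain ⟨t, ht⟩ := hN (g n).1 (g n).2 (f n) ψ hn (hat n h)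
    exact ⟨t, n + 1, ht⟩
  · intro ψ h
    obtain ⟨n, hn⟩ := hf (¬ᶠ(Fml.allS ψ))
    rw [← hn] at h
    obtain ⟨t, ht⟩ := hS (g n).1 (g n).2 (f n) ψ hn (hat n h)
    exact ⟨t, n + 1, ht⟩
  · exact fun φ hφ => ⟨0, .hyp hφ⟩

/-! ## The term model -/

namespace IsHenkin

variable {H : Fml → Prop}

theorem of_proves (hH : IsHenkin T H) {φ : Fml} (h : Proves T [] φ) : H φ := hH.closed (by simp) h

theorem imp_iff (hH : IsHenkin T H) {φ ψ : Fml} : H (φ →ᶠ ψ) ↔ (H φ → H ψ) := by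
  constructor
  · intro h h'
    refine hH.closed (Γ := [φ →ᶠ ψ, φ]) (by simp [h, h']) ?_
    exact .impE (φ := φ) (.hyp (by simp)) (.hyp (by simp))
  · intro h
    rcases hH.complete φ with h' | h'
    · exact hH.closed (Γ := [ψ]) (by simp [h h']) (.impI (.hyp (by simp)))
    · refine hH.closed (Γ := [¬ᶠφ]) (by simp [h']) (.impI (Proves.falsumE ?_))
      exact .impE (φ := φ) (.hyp (by simp [Fml.neg])) (.hyp (by simp))

theorem neg_iff (hH : IsHenkin T H) {φ : Fml} : H ¬ᶠφ ↔ ¬ H φ := by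
  rw [Fml.neg, hH.imp_iff]
  exact ⟨fun h h' => hH.consistent (h h'), fun h h' => (h h').elim⟩

theorem allN_iff (hH : IsHenkin T H) {φ : Fml} : H (.allN φ) ↔ ∀ t, H (φ.instN t) := by
  constructor
  · exact fun h t => hH.closed (Γ := [.allN φ]) (by simpa using h) (.allNE t (.hyp (by simp)))
  · intro h
    by_contra h'
    obtain ⟨t, ht⟩ := hH.witnessN φ (hH.neg_iff.2 h')
    exact hH.neg_iff.1 ht (h t)

theorem allS_iff (hH : IsHenkin T H) {φ : Fml} : H (.allS φ) ↔ ∀ Y, H (φ.instS Y) := by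
  constructor
  · exact fun h t => hH.closed (Γ := [.allS φ]) (by simpa using h) (.allSE t (.hyp (by simp)))
  · intro h
    by_contra h'
    obtain ⟨t, ht⟩ := hH.witnessS φ (hH.neg_iff.2 h')
    exact hH.neg_iff.1 ht (h t)

-- Equality and congruence in a Henkin theory

theorem eqN_subst (hH : IsHenkin T H) {s t : Term} (φ : Fml) (h : H (s =ᶠ t)) (h' : H (φ.instN s)) :
    H (φ.instN t) := by
  refine hH.closed (Γ := [s =ᶠ t, φ.instN s]) (by simp [h, h']) ?_
  exact .eqNSubst φ (s := s) (.hyp (by simp)) (.hyp (by simp))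

theorem eqS_subst (hH : IsHenkin T H) {X Y : ℕ} (φ : Fml) (h : H (.eqS X Y)) (h' : H (φ.instS X)) :
    H (φ.instS Y) := by
  refine hH.closed (Γ := [.eqS X Y, φ.instS X]) (by simp [h, h']) ?_
  exact .eqSSubst φ (X := X) (.hyp (by simp)) (.hyp (by simp))

theorem eqN_refl (hH : IsHenkin T H) (t : Term) : H (t =ᶠ t) := hH.of_proves (.eqNRefl t)

theorem eqN_symm (hH : IsHenkin T H) {s t : Term} (h : H (s =ᶠ t)) : H (t =ᶠ s) := by
  have := hH.eqN_subst (♯0 =ᶠ s.up) h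
  simp only [Fml.instN, Fml.subst, Term.up_subst_consN] at this
  exact this (hH.eqN_refl s)

theorem eqN_trans (hH : IsHenkin T H) {r s t : Term} (h : H (r =ᶠ s)) (h' : H (s =ᶠ t)) :
    H (r =ᶠ t) := by
  have := hH.eqN_subst (r.up =ᶠ ♯0) h'
  simp only [Fml.instN, Fml.subst, Term.up_subst_consN] at this
  exact this h

theorem eqS_refl (hH : IsHenkin T H) (X : ℕ) : H (.eqS X X) := hH.of_proves (.eqSRefl X)

theorem eqS_symm (hH : IsHenkin T H) {X Y : ℕ} (h : H (.eqS X Y)) : H (.eqS Y X) :=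
  hH.eqS_subst (.eqS 0 (X + 1)) h (hH.eqS_refl X)

theorem eqS_trans (hH : IsHenkin T H) {X Y Z : ℕ} (h : H (.eqS X Y)) (h' : H (.eqS Y Z)) :
    H (.eqS X Z) :=
  hH.eqS_subst (.eqS (X + 1) 0) h' h

theorem add_congr (hH : IsHenkin T H) {s s' t t' : Term} (h : H (s =ᶠ s')) (h' : H (t =ᶠ t')) :
    H (s +ᶠ t =ᶠ s' +ᶠ t') := by
  have h₁ := hH.eqN_subst (s.up +ᶠ t.up =ᶠ ♯0 +ᶠ t.up) h
  have h₂ := hH.eqN_subst (s.up +ᶠ t.up =ᶠ s'.up +ᶠ ♯0) h'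
  simp only [Fml.instN, Fml.subst, Term.subst, Term.up_subst_consN] at h₁ h₂
  exact h₂ (h₁ (hH.eqN_refl _))

theorem mul_congr (hH : IsHenkin T H) {s s' t t' : Term} (h : H (s =ᶠ s')) (h' : H (t =ᶠ t')) :
    H (s *ᶠ t =ᶠ s' *ᶠ t') := by
  have h₁ := hH.eqN_subst (s.up *ᶠ t.up =ᶠ ♯0 *ᶠ t.up) h
  have h₂ := hH.eqN_subst (s.up *ᶠ t.up =ᶠ s'.up *ᶠ ♯0) h'
  simp only [Fml.instN, Fml.subst, Term.subst, Term.up_subst_consN] at h₁ h₂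
  exact h₂ (h₁ (hH.eqN_refl _))

theorem le_congr (hH : IsHenkin T H) {s s' t t' : Term} (h : H (s =ᶠ s')) (h' : H (t =ᶠ t'))
    (hle : H (s ≤ᶠ t)) :
    H (s' ≤ᶠ t') := by
  have h₁ := hH.eqN_subst (♯0 ≤ᶠ t.up) h
  have h₂ := hH.eqN_subst (s'.up ≤ᶠ ♯0) h'
  simp only [Fml.instN, Fml.subst, Term.up_subst_consN] at h₁ h₂
  exact h₂ (h₁ hle)

theorem len_congr (hH : IsHenkin T H) {X Y : ℕ} (h : H (.eqS X Y)) : H (.len X =ᶠ .len Y) :=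
  hH.eqS_subst (.len (X + 1) =ᶠ .len 0) h (hH.eqN_refl _)

theorem mem_congr (hH : IsHenkin T H) {s t : Term} {X Y : ℕ} (h : H (s =ᶠ t)) (h' : H (.eqS X Y))
    (hm : H (s ∈ᶠ X)) : H (t ∈ᶠ Y) := by
  have h₁ := hH.eqN_subst (♯0 ∈ᶠ X) h
  have h₂ := hH.eqS_subst (t.upS ∈ᶠ 0) h'
  simp only [Fml.instS, Fml.subst, Term.upS_subst_consS] at h₂
  exact h₂ (h₁ hm)

def setoidN (hH : IsHenkin T H) : Setoid Term where
  r s t := H (s =ᶠ t)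
  iseqv := ⟨hH.eqN_refl, hH.eqN_symm, hH.eqN_trans⟩

def setoidS (hH : IsHenkin T H) : Setoid ℕ where
  r X Y := H (.eqS X Y)
  iseqv := ⟨hH.eqS_refl, hH.eqS_symm, hH.eqS_trans⟩

/-- Classes of variables suffice for the set sort: variables are its only terms, and the Henkin
witnesses for set quantifiers are variables. -/
def model (hH : IsHenkin T H) : Str where
  N := Quotient hH.setoidN
  S := Quotient hH.setoidS
  zero := Quotient.mk _ .zero
  one := Quotient.mk _ .one
  add := Quotient.map₂ Term.add fun _ _ h _ _ h' => hH.add_congr h h'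
  mul := Quotient.map₂ Term.mul fun _ _ h _ _ h' => hH.mul_congr h h'
  le := Quotient.lift₂ (fun s t => H (s ≤ᶠ t)) fun _ _ _ _ h h' =>
    propext ⟨hH.le_congr h h', hH.le_congr (hH.eqN_symm h) (hH.eqN_symm h')⟩
  len := Quotient.map Term.len fun _ _ h => hH.len_congr h
  mem := Quotient.lift₂ (fun t X => H (t ∈ᶠ X)) fun _ _ _ _ h h' =>
    propext ⟨hH.mem_congr h h', hH.mem_congr (hH.eqN_symm h) (hH.eqS_symm h')⟩
  setDefault := Quotient.mk _ 0

theorem val_model (hH : IsHenkin T H) (σ : ℕ → Term) (ρ : ℕ → ℕ) (t : Term) :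
    hH.model.val (fun k => Quotient.mk hH.setoidN (σ k)) (fun X => Quotient.mk hH.setoidS (ρ X)) t
      = Quotient.mk hH.setoidN (t.subst σ ρ) := by
  induction t with
  | add s t hs ht | mul s t hs ht => simp only [Str.val, hs, ht]; rfl
  | _ => rfl

/-- Truth lemma. It is stated for all substitutions because a quantifier prepends an arbitrary class
to the environment; representatives of the classes turn this into instantiation. -/
theorem sat_model (hH : IsHenkin T H) (φ : Fml) : ∀ (σ : ℕ → Term) (ρ : ℕ → ℕ),
    hH.model.Sat (fun k => Quotient.mk hH.setoidN (σ k)) (fun X => Quotient.mk hH.setoidS (ρ X)) φ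
      ↔ H (φ.subst σ ρ) := by
  induction φ with
  | falsum => exact fun σ ρ => iff_of_false id hH.consistent
  | eqN s t =>
    intro σ ρ
    simp only [Str.Sat, val_model]
    exact Quotient.eq
  | eqS X Y => exact fun σ ρ => Quotient.eq
  | le s t =>
    intro σ ρ
    simp only [Str.Sat, val_model]
    exact Iff.rfl
  | mem t X =>
    intro σ ρ
    simp only [Str.Sat, val_model]
    exact Iff.rfl
  | imp φ ψ hφ hψ =>
    intro σ ρ
    simp only [Str.Sat, Fml.subst, hH.imp_iff, hφ, hψ]
  | allN φ ih =>
    intro σ ρ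
    simp only [Str.Sat, Fml.subst, hH.allN_iff, Fml.subst_liftN_instN, ← ih]
    simp only [scons_comp (Quotient.mk hH.setoidN)]
    exact ⟨fun h t => h _, fun h x => Quotient.inductionOn x h⟩
  | allS φ ih =>
    intro σ ρ
    simp only [Str.Sat, Fml.subst, hH.allS_iff, Fml.subst_liftS_instS, ← ih]
    simp only [scons_comp (Quotient.mk hH.setoidS)]
    exact ⟨fun h t => h _, fun h x => Quotient.inductionOn x h⟩

end IsHenkin

/-- Completeness: what holds in all models of `T` is derivable from `T`. -/
theorem proves_of_forall_model {φ : Fml}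
    (h : ∀ M : Str, (∀ ψ ∈ T, ∀ e s, M.Sat e s ψ) → ∀ e s, M.Sat e s φ) : Proves T [] φ := by
  by_contra hφ
  obtain ⟨H, hH, hmem⟩ := exists_isHenkin (T := T) [¬ᶠφ] fun hf => hφ (.raa hf)
  have hn : ¬ H φ := hH.neg_iff.1 (hmem _ (by simp))
  have := h hH.model ?_ (fun k => Quotient.mk _ ♯k) (fun X => Quotient.mk _ X)
  · refine hn ?_
    rw [← φ.subst_id]
    exact (hH.sat_model φ Term.var id).1 this
  · intro ψ hψ e s
    -- Every environment is given by representatives, so truth of an axiom in it means membership of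
    -- a substitution instance in `H`.
    have he : e = fun k => Quotient.mk hH.setoidN (e k).out :=
      funext fun k => (Quotient.out_eq (e k)).symm
    have hs : s = fun k => Quotient.mk hH.setoidS (s k).out :=
      funext fun k => (Quotient.out_eq (s k)).symm
    rw [he, hs, hH.sat_model]
    exact hH.of_proves (proves_subst_of_forall (fun _ => .ax hψ) _ _ _)

end BA

namespace BA

/-! ## Evaluation of defined connectives -/

namespace Str

variable (M : Str)

instance : Zero M.N := ⟨M.zero⟩
instance : One M.N := ⟨M.one⟩
instance : Add M.N := ⟨M.add⟩
instance : Mul M.N := ⟨M.mul⟩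
instance : LE M.N := ⟨M.le⟩

variable {M} (e : ℕ → M.N) (s : ℕ → M.S)

@[simp] theorem val_var (k : ℕ) : M.val e s ♯k = e k := rfl
@[simp] theorem val_zero : M.val e s .zero = 0 := rfl
@[simp] theorem val_one : M.val e s .one = 1 := rfl
@[simp] theorem val_add (a b : Term) : M.val e s (a +ᶠ b) = M.val e s a + M.val e s b := rfl
@[simp] theorem val_mul (a b : Term) : M.val e s (a *ᶠ b) = M.val e s a * M.val e s b := rfl
@[simp] theorem val_len (X : ℕ) : M.val e s (.len X) = M.len (s X) := rfl

theorem val_subst (σ : ℕ → Term) (ρ : ℕ → ℕ) (t : Term) :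
    M.val e s (t.subst σ ρ) = M.val (fun k => M.val e s (σ k)) (fun X => s (ρ X)) t := by
  induction t with
  | add a b ha hb | mul a b ha hb => simp only [Term.subst, Str.val, ha, hb]
  | _ => rfl

@[simp] theorem val_up (x : M.N) (t : Term) : M.val (scons x e) s t.up = M.val e s t :=
  val_subst ..

@[simp] theorem val_upS (X : M.S) (t : Term) : M.val e (scons X s) t.upS = M.val e s t :=
  val_subst ..

theorem sat_subst (φ : Fml) : ∀ (e : ℕ → M.N) (s : ℕ → M.S) (σ : ℕ → Term) (ρ : ℕ → ℕ),
    M.Sat e s (φ.subst σ ρ) ↔ M.Sat (fun k => M.val e s (σ k)) (fun X => s (ρ X)) φ := by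
  induction φ with
  | imp φ ψ hφ hψ => intros; simp only [Fml.subst, Str.Sat, hφ, hψ]
  | allN φ ih =>
    intro e s σ ρ
    simp only [Fml.subst, Str.Sat, ih]
    refine forall_congr' fun x => iff_of_eq ?_
    congr 1
    funext k
    cases k with
    | zero => rfl
    | succ k => exact val_up ..
  | allS φ ih =>
    intro e s σ ρ
    simp only [Fml.subst, Str.Sat, ih]
    refine forall_congr' fun x => iff_of_eq ?_
    congr 1
    · funext k; exact val_upS ..
    · funext k; cases k <;> rfl
  | _ => intros; simp only [Fml.subst, Str.Sat, val_subst]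

@[simp] theorem sat_upS (X : M.S) (φ : Fml) : M.Sat e (scons X s) φ.upS ↔ M.Sat e s φ :=
  sat_subst ..

@[simp] theorem sat_eqN (a b : Term) : M.Sat e s (a =ᶠ b) ↔ M.val e s a = M.val e s b := Iff.rfl
@[simp] theorem sat_le (a b : Term) : M.Sat e s (a ≤ᶠ b) ↔ M.val e s a ≤ M.val e s b := Iff.rfl
@[simp] theorem sat_mem (a : Term) (X : ℕ) :
    M.Sat e s (a ∈ᶠ X) ↔ M.mem (M.val e s a) (s X) := Iff.rfl
@[simp] theorem sat_imp (φ ψ : Fml) :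
    M.Sat e s (φ →ᶠ ψ) ↔ (M.Sat e s φ → M.Sat e s ψ) := Iff.rfl
@[simp] theorem sat_allN (φ : Fml) :
    M.Sat e s (.allN φ) ↔ ∀ x, M.Sat (scons x e) s φ := Iff.rfl
@[simp] theorem sat_allS (φ : Fml) :
    M.Sat e s (.allS φ) ↔ ∀ X, M.Sat e (scons X s) φ := Iff.rfl
@[simp] theorem sat_neg (φ : Fml) : M.Sat e s ¬ᶠφ ↔ ¬ M.Sat e s φ := Iff.rfl
@[simp] theorem sat_and (φ ψ : Fml) :
    M.Sat e s (φ ∧ᶠ ψ) ↔ M.Sat e s φ ∧ M.Sat e s ψ := by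
  simp [Fml.and]
@[simp] theorem sat_or (φ ψ : Fml) :
    M.Sat e s (φ ∨ᶠ ψ) ↔ M.Sat e s φ ∨ M.Sat e s ψ := by
  simp [Fml.or, or_iff_not_imp_left]
@[simp] theorem sat_iff (φ ψ : Fml) :
    M.Sat e s (φ ↔ᶠ ψ) ↔ (M.Sat e s φ ↔ M.Sat e s ψ) := by
  simp [Fml.iff, iff_def]
@[simp] theorem sat_exN (φ : Fml) :
    M.Sat e s (.exN φ) ↔ ∃ x, M.Sat (scons x e) s φ := by
  simp [Fml.exN]
@[simp] theorem sat_exS (φ : Fml) :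
    M.Sat e s (.exS φ) ↔ ∃ X, M.Sat e (scons X s) φ := by
  simp [Fml.exS]
@[simp] theorem sat_allLe (t : Term) (φ : Fml) :
    M.Sat e s (allLe t φ) ↔ ∀ x ≤ M.val e s t, M.Sat (scons x e) s φ := by
  simp [allLe]
@[simp] theorem sat_exLe (t : Term) (φ : Fml) :
    M.Sat e s (exLe t φ) ↔ ∃ x ≤ M.val e s t, M.Sat (scons x e) s φ := by
  simp [exLe]
@[simp] theorem sat_exSLe (t : Term) (φ : Fml) :
    M.Sat e s (exSLe t φ) ↔ ∃ X, M.len X ≤ M.val e s t ∧ M.Sat e (scons X s) φ := by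
  simp [exSLe]

end Str

/-! ## Arithmetic in models of `V¹` -/

/-- Models of `V¹`. -/
structure V1Model extends Str where
  sat : ∀ φ ∈ V1, ∀ e s, toStr.Sat e s φ

namespace V1Model

variable {M : V1Model}

theorem ind {φ : Fml} (hφ : Sigma1 φ) (e : ℕ → M.N) (s : ℕ → M.S)
    (h0 : M.Sat (scons 0 e) s φ)
    (hs : ∀ x, M.Sat (scons x e) s φ → M.Sat (scons (x + 1) e) s φ) (x : M.N) :
    M.Sat (scons x e) s φ := by
  have := M.sat _ (V1.ind hφ) e s
  simp only [Str.sat_imp, Str.sat_and, Str.sat_allN, Fml.instN, Fml.atSucc, Str.sat_subst] at this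
  refine this ⟨?_, fun x hx => ?_⟩ x
  · convert h0 using 2
    · rename_i k; cases k <;> rfl
    · rfl
  · convert hs x hx using 2
    · rename_i k; cases k <;> rfl
    · rfl

/-- The environment in which all number variables are `0`. -/
def e₀ : ℕ → M.N := fun _ => 0
/-- An arbitrary environment for set variables. -/
def s₀ : ℕ → M.S := fun _ => M.setDefault

theorem indN {φ : Fml} (hφ : Sigma0 φ) (e : ℕ → M.N)
    (h0 : M.Sat (scons 0 e) s₀ φ)
    (hs : ∀ x, M.Sat (scons x e) s₀ φ → M.Sat (scons (x + 1) e) s₀ φ) (x : M.N) :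
    M.Sat (scons x e) s₀ φ := ind (.of0 hφ) e s₀ h0 hs x

theorem succ_ne_zero (x : M.N) : x + 1 ≠ 0 := M.sat _ .B1 (scons x e₀) s₀
theorem succ_inj {x y : M.N} : x + 1 = y + 1 → x = y := M.sat _ .B2 (scons x (scons y e₀)) s₀
theorem add_zero' (x : M.N) : x + 0 = x := M.sat _ .B3 (scons x e₀) s₀
theorem add_succ (x y : M.N) : x + (y + 1) = x + y + 1 := M.sat _ .B4 (scons x (scons y e₀)) s₀
theorem mul_zero' (x : M.N) : x * 0 = 0 := M.sat _ .B5 (scons x e₀) s₀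
theorem mul_succ (x y : M.N) : x * (y + 1) = x * y + x := M.sat _ .B6 (scons x (scons y e₀)) s₀
theorem le_antisymm' {x y : M.N} (h : x ≤ y) (h' : y ≤ x) : x = y := by
  have := M.sat _ .B7 (scons x (scons y e₀)) s₀
  simp only [Str.sat_imp, Str.sat_and] at this
  exact this ⟨h, h'⟩
theorem le_add (x y : M.N) : x ≤ x + y := M.sat _ .B8 (scons x (scons y e₀)) s₀
theorem zero_le' (x : M.N) : 0 ≤ x := M.sat _ .B9 (scons x e₀) s₀
theorem le_total' (x y : M.N) : x ≤ y ∨ y ≤ x := by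
  simpa using M.sat _ .B10 (scons x (scons y e₀)) s₀
theorem le_iff_lt_succ (x y : M.N) : x ≤ y ↔ x ≤ y + 1 ∧ x ≠ y + 1 := by
  simpa [Fml.lt] using M.sat _ .B11 (scons x (scons y e₀)) s₀
theorem exists_succ {x : M.N} (h : x ≠ 0) : ∃ y, y + 1 = x := by
  have := M.sat _ .B12 (scons x (scons x e₀)) s₀
  simp at this
  obtain ⟨y, -, hy⟩ := this h
  exact ⟨y, hy⟩

-- Semiring and order laws by open induction

theorem zero_add' (x : M.N) : 0 + x = x := by
  refine indN (φ := .zero +ᶠ ♯0 =ᶠ ♯0) (.eqN _ _) e₀ ?_ (fun x h => ?_) x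
  · exact add_zero' 0
  · simp at h ⊢; rw [add_succ, h]

theorem add_assoc' (a b x : M.N) : a + b + x = a + (b + x) := by
  refine indN (φ := ♯1 +ᶠ ♯2 +ᶠ ♯0 =ᶠ ♯1 +ᶠ (♯2 +ᶠ ♯0)) (.eqN _ _) (scons a (scons b e₀)) ?_
    (fun x h => ?_) x
  · simp [add_zero']
  · simp at h ⊢; rw [add_succ, h, add_succ, add_succ]

theorem succ_add (a x : M.N) : a + 1 + x = a + x + 1 := by
  refine indN (φ := ♯1 +ᶠ .one +ᶠ ♯0 =ᶠ ♯1 +ᶠ ♯0 +ᶠ .one) (.eqN _ _) (scons a e₀) ?_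
    (fun x h => ?_) x
  · simp [add_zero']
  · simp at h ⊢; rw [add_succ, h, add_succ]

theorem add_comm' (a x : M.N) : a + x = x + a := by
  refine indN (φ := ♯1 +ᶠ ♯0 =ᶠ ♯0 +ᶠ ♯1) (.eqN _ _) (scons a e₀) ?_ (fun x h => ?_) x
  · simp [add_zero', zero_add']
  · simp at h ⊢; rw [add_succ, h, succ_add]

theorem zero_mul' (x : M.N) : 0 * x = 0 := by
  refine indN (φ := .zero *ᶠ ♯0 =ᶠ .zero) (.eqN _ _) e₀ ?_ (fun x h => ?_) x
  · exact mul_zero' 0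
  · simp at h ⊢; rw [mul_succ, h, add_zero']

theorem succ_mul (a x : M.N) : (a + 1) * x = a * x + x := by
  refine indN (φ := (♯1 +ᶠ .one) *ᶠ ♯0 =ᶠ ♯1 *ᶠ ♯0 +ᶠ ♯0) (.eqN _ _) (scons a e₀) ?_
    (fun x h => ?_) x
  · simp [add_zero', mul_zero']
  · simp at h ⊢
    rw [mul_succ, h, mul_succ, add_succ, add_succ, add_assoc' _ x, add_comm' x a, ← add_assoc']

theorem mul_comm' (a x : M.N) : a * x = x * a := by
  refine indN (φ := ♯1 *ᶠ ♯0 =ᶠ ♯0 *ᶠ ♯1) (.eqN _ _) (scons a e₀) ?_ (fun x h => ?_) x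
  · simp [mul_zero', zero_mul']
  · simp at h ⊢; rw [mul_succ, h, succ_mul]

theorem mul_add' (a b x : M.N) : a * (b + x) = a * b + a * x := by
  refine indN (φ := ♯1 *ᶠ (♯2 +ᶠ ♯0) =ᶠ ♯1 *ᶠ ♯2 +ᶠ ♯1 *ᶠ ♯0) (.eqN _ _) (scons a (scons b e₀))
    ?_ (fun x h => ?_) x
  · simp [mul_zero', add_zero']
  · simp at h ⊢; rw [add_succ, mul_succ, h, mul_succ, add_assoc']

theorem mul_assoc' (a b x : M.N) : a * b * x = a * (b * x) := by
  refine indN (φ := ♯1 *ᶠ ♯2 *ᶠ ♯0 =ᶠ ♯1 *ᶠ (♯2 *ᶠ ♯0)) (.eqN _ _) (scons a (scons b e₀))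
    ?_ (fun x h => ?_) x
  · simp [mul_zero']
  · simp at h ⊢; rw [mul_succ, h, mul_succ, mul_add']

theorem mul_one' (x : M.N) : x * 1 = x := by
  rw [← zero_add' 1, mul_succ, mul_zero', zero_add']

theorem add_right_cancel' {a b : M.N} (x : M.N) : a + x = b + x → a = b := by
  refine indN (φ := ♯1 +ᶠ ♯0 =ᶠ ♯2 +ᶠ ♯0 →ᶠ ♯1 =ᶠ ♯2) (.imp (.eqN _ _) (.eqN _ _))
    (scons a (scons b e₀)) ?_ (fun x h => ?_) x
  · simp [add_zero']
  · simp at h ⊢; rw [add_succ, add_succ]; exact fun h' => h (succ_inj h')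

instance : CommSemiring M.N where
  add_assoc := add_assoc'
  zero_add := zero_add'
  add_zero := add_zero'
  add_comm := add_comm'
  left_distrib := mul_add'
  right_distrib a b c := by rw [mul_comm', mul_add', mul_comm' c, mul_comm' c]
  zero_mul := zero_mul'
  mul_zero := mul_zero'
  mul_assoc := mul_assoc'
  one_mul x := by rw [mul_comm', mul_one']
  mul_one := mul_one'
  mul_comm := mul_comm'
  nsmul := nsmulRec
  npow := npowRec

/-- The axioms only give `x ≤ x + y`; this converse supplies subtraction, by induction on `y`. The
difference is bounded by `y` to keep the induction formula in $\Sigma^{1,b}_0$. -/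
theorem exists_add_of_le' {x y : M.N} : x ≤ y → ∃ z, y = x + z := by
  have := indN (φ := ♯1 ≤ᶠ ♯0 →ᶠ exLe ♯0 (♯1 =ᶠ ♯2 +ᶠ ♯0))
    (.imp (.le _ _) (.exLe _ (.eqN _ _))) (scons x e₀) ?_ (fun y h => ?_) y
  · simp at this
    exact fun h => (this h).imp fun z hz => hz.2
  · simp
    exact fun h => ⟨0, zero_le' 0, by rw [add_zero, le_antisymm' h (zero_le' x)]⟩
  · simp at h ⊢
    intro hxy
    by_cases hx : x = y + 1
    · exact ⟨0, zero_le' _, by rw [add_zero, hx]⟩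
    · obtain ⟨z, hz, rfl⟩ := h ((le_iff_lt_succ x y).2 ⟨hxy, hx⟩)
      refine ⟨z + 1, ?_, by rw [add_assoc]⟩
      rw [add_assoc, add_comm x]
      exact le_add _ _

noncomputable instance : LinearOrder M.N where
  le_refl x := by simpa using le_add x 0
  le_trans x y z h h' := by
    obtain ⟨u, rfl⟩ := exists_add_of_le' h
    obtain ⟨v, rfl⟩ := exists_add_of_le' h'
    rw [add_assoc]; exact le_add _ _
  le_antisymm x y := le_antisymm'
  le_total := le_total'
  toDecidableLE := Classical.decRel _

instance : IsCancelAdd M.N where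
  add_right_cancel x _ _ := add_right_cancel' x
  add_left_cancel x a b h := add_right_cancel' x (by simpa only [add_comm _ x] using h)

instance : CanonicallyOrderedAdd M.N where
  exists_add_of_le := exists_add_of_le'
  le_self_add := le_add
  le_add_self x y := by rw [add_comm]; exact le_add _ _

instance : IsOrderedCancelAddMonoid M.N where
  add_le_add_left a b h c := by
    obtain ⟨u, rfl⟩ := exists_add_of_le' h
    rw [add_right_comm]; exact le_add _ _
  le_of_add_le_add_left a b c h := by
    obtain ⟨u, hu⟩ := exists_add_of_le' h
    rw [add_assoc] at hu
    rw [add_left_cancel hu]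
    exact le_add _ _

instance : Nontrivial M.N := ⟨⟨0 + 1, 0, succ_ne_zero 0⟩⟩

theorem lt_succ_iff {x y : M.N} : x < y + 1 ↔ x ≤ y := by
  rw [le_iff_lt_succ, lt_iff_le_and_ne]

theorem succ_le_iff {x y : M.N} : x + 1 ≤ y ↔ x < y := by
  rw [← not_lt, lt_succ_iff, not_le]

instance : NoZeroDivisors M.N where
  eq_zero_or_eq_zero_of_mul_eq_zero {a b} h := by
    by_contra! hab
    obtain ⟨x, rfl⟩ := exists_succ hab.1
    obtain ⟨y, rfl⟩ := exists_succ hab.2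
    rw [mul_succ, ← add_assoc] at h
    exact succ_ne_zero _ h

instance : IsStrictOrderedRing M.N where
  zero_le_one := zero_le' 1
  mul_lt_mul_of_pos_left := by
    intro c hc a b h
    obtain ⟨u, rfl⟩ := exists_add_of_le' h.le
    have hu : u ≠ 0 := by rintro rfl; simp at h
    rw [mul_add]
    exact lt_add_of_pos_right _ (pos_iff_ne_zero.2 (mul_ne_zero hc.ne' hu))
  mul_lt_mul_of_pos_right := by
    intro c hc a b h
    obtain ⟨u, rfl⟩ := exists_add_of_le' h.le
    have hu : u ≠ 0 := by rintro rfl; simp at h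
    rw [add_mul]
    exact lt_add_of_pos_right _ (pos_iff_ne_zero.2 (mul_ne_zero hu hc.ne'))

end V1Model
end BA

namespace BA

/-! ## Closure properties of `Σ^{1,b}_0` -/

namespace Sigma0

variable {φ ψ : Fml}

theorem neg (h : Sigma0 φ) : Sigma0 ¬ᶠφ := .imp h .falsum
theorem and (h : Sigma0 φ) (k : Sigma0 ψ) : Sigma0 (φ ∧ᶠ ψ) := neg (.imp h (neg k))
theorem or (h : Sigma0 φ) (k : Sigma0 ψ) : Sigma0 (φ ∨ᶠ ψ) := .imp (neg h) k
theorem iff (h : Sigma0 φ) (k : Sigma0 ψ) : Sigma0 (φ ↔ᶠ ψ) := and (.imp h k) (.imp k h)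
theorem lt (s t : Term) : Sigma0 (s <ᶠ t) := and (.le _ _) (neg (.eqN _ _))
theorem allLt (t : Term) (h : Sigma0 φ) : Sigma0 (allLt t φ) := .allLe _ (.imp (lt _ _) h)
theorem exLt (t : Term) (h : Sigma0 φ) : Sigma0 (exLt t φ) := .exLe _ (and (lt _ _) h)
theorem isPair (s t z : Term) : Sigma0 (isPair s t z) := .eqN _ _
theorem mem2 (X : ℕ) (s t : Term) : Sigma0 (mem2 X s t) :=
  exLt _ (and (isPair _ _ _) (.mem _ _))
theorem mem3 (X : ℕ) (r s t : Term) : Sigma0 (mem3 X r s t) :=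
  exLt _ (and (isPair _ _ _) (mem2 _ _ _))
theorem mem4 (X : ℕ) (q r s t : Term) : Sigma0 (mem4 X q r s t) :=
  exLt _ (and (isPair _ _ _) (mem3 _ _ _ _))
theorem mem5 (X : ℕ) (p q r s t : Term) : Sigma0 (mem5 X p q r s t) :=
  exLt _ (and (isPair _ _ _) (mem4 _ _ _ _ _))
theorem memEdge (X : ℕ) (i a j b : Term) : Sigma0 (memEdge X i a j b) :=
  exLt _ (exLt _ (and (isPair _ _ _) (and (isPair _ _ _) (mem2 _ _ _))))

/-- Comprehension is applied to formulas with renumbered variables, so the class must be closed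
under substitution; weakened bounds stay weakened under a lifted substitution. -/
theorem subst (h : Sigma0 φ) : ∀ (σ : ℕ → Term) (ρ : ℕ → ℕ), Sigma0 (φ.subst σ ρ) := by
  induction h with
  | falsum => exact fun _ _ => .falsum
  | eqN s t => exact fun _ _ => .eqN _ _
  | eqS X Y => exact fun _ _ => .eqS _ _
  | le s t => exact fun _ _ => .le _ _
  | mem t X => exact fun _ _ => .mem _ _
  | imp _ _ h₁ h₂ => exact fun σ ρ => .imp (h₁ σ ρ) (h₂ σ ρ)
  | allLe t _ ih =>
    intro σ ρ
    have := Sigma0.allLe (t.subst σ ρ) (ih (liftN σ) ρ)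
    rwa [BA.allLe, ← Term.up_subst_liftN] at this
  | exLe t _ ih =>
    intro σ ρ
    have := Sigma0.exLe (t.subst σ ρ) (ih (liftN σ) ρ)
    rwa [BA.exLe, ← Term.up_subst_liftN] at this

end Sigma0

namespace V1Model

variable {M : V1Model}

section Sat

variable (e : ℕ → M.N) (s : ℕ → M.S)

@[simp] theorem sat_lt (a b : Term) : M.Sat e s (a <ᶠ b) ↔ M.val e s a < M.val e s b := by
  simp [Fml.lt, lt_iff_le_and_ne]
@[simp] theorem sat_allLt (t : Term) (φ : Fml) :
    M.Sat e s (allLt t φ) ↔ ∀ x < M.val e s t, M.Sat (scons x e) s φ := by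
  simp only [allLt, Str.sat_allLe, Str.sat_imp, sat_lt, Str.val_up, Str.val_var, scons_zero]
  exact forall_congr' fun x => ⟨fun h hx => h hx.le hx, fun h _ => h⟩
@[simp] theorem sat_exLt (t : Term) (φ : Fml) :
    M.Sat e s (exLt t φ) ↔ ∃ x < M.val e s t, M.Sat (scons x e) s φ := by
  simp only [exLt, Str.sat_exLe, Str.sat_and, sat_lt, Str.val_up, Str.val_var, scons_zero]
  exact exists_congr fun x => ⟨fun h => h.2, fun h => ⟨h.1.le, h⟩⟩

end Sat

/-! ## Pairs -/

/-- Division by two in the pairing function: adding `x + 1` passes from one triangular number to the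
next. The bound on the half makes the induction formula $\Sigma^{1,b}_0$. -/
theorem exists_half (x : M.N) : ∃ y, y + y = x * (x + 1) := by
  have := indN (φ := exLe (♯0 *ᶠ (♯0 +ᶠ .one)) (♯0 +ᶠ ♯0 =ᶠ ♯1 *ᶠ (♯1 +ᶠ .one)))
    (.exLe _ (.eqN _ _)) e₀ ?_ (fun x h => ?_) x
  · simp at this
    obtain ⟨y, -, hy⟩ := this
    exact ⟨y, hy⟩
  · simp
  · simp at h ⊢
    obtain ⟨y, -, hy⟩ := h
    have : y + (x + 1) + (y + (x + 1)) = (x + 1) * (x + 1 + 1) := by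
      calc y + (x + 1) + (y + (x + 1)) = (y + y) + ((x + 1) + (x + 1)) := by ring
        _ = _ := by rw [hy]; ring
    exact ⟨y + (x + 1), by rw [← this]; exact le_self_add, this⟩

theorem exists_pair (x y : M.N) : ∃ z, z + z = (x + y) * (x + y + 1) + (y + y) := by
  obtain ⟨z, hz⟩ := exists_half (x + y)
  exact ⟨z + y, by rw [← hz]; ring⟩

/-- The pairing function. -/
noncomputable def pair (x y : M.N) : M.N := (exists_pair x y).choose

theorem pair_spec (x y : M.N) : pair x y + pair x y = (x + y) * (x + y + 1) + (y + y) :=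
  (exists_pair x y).choose_spec

theorem add_self_inj {x y : M.N} (h : x + x = y + y) : x = y := by
  rcases lt_trichotomy x y with h' | h' | h'
  · exact absurd h (add_lt_add h' h').ne
  · exact h'
  · exact absurd h (add_lt_add h' h').ne'

theorem le_of_add_self_le {x y : M.N} (h : x + x ≤ y + y) : x ≤ y :=
  le_of_not_gt fun h' => absurd h (add_lt_add h' h').not_ge

theorem eq_pair_iff {x y z : M.N} :
    z + z = (x + y) * (x + y + 1) + (y + y) ↔ z = pair x y := by
  rw [← pair_spec]
  exact ⟨add_self_inj, fun h => by rw [h]⟩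

/-- Cantor pairing runs through the diagonals in order: with $s=x+y$ one has $2\langle
x,y\rangle<(s+1)(s+2)\le 2\langle x',y'\rangle$. -/
theorem pair_lt_of_add_lt {x y x' y' : M.N} (h : x + y < x' + y') : pair x y < pair x' y' := by
  by_contra! h'
  have h₁ : (x' + y') * (x' + y' + 1) ≤ pair x' y' + pair x' y' := by
    rw [pair_spec]; exact le_self_add
  have h₂ : (x + y + 1) * (x + y + 1 + 1) ≤ (x' + y') * (x' + y' + 1) := by
    have := succ_le_iff.2 h
    gcongr
  have h₃ : pair x y + pair x y < (x + y + 1) * (x + y + 1 + 1) := by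
    rw [pair_spec]
    calc (x + y) * (x + y + 1) + (y + y)
        ≤ (x + y) * (x + y + 1) + ((x + y) + (x + y)) := by gcongr <;> exact le_add_self
      _ < (x + y) * (x + y + 1) + ((x + y) + (x + y)) + 1 + 1 :=
          (lt_succ_iff.2 le_rfl).trans (lt_succ_iff.2 le_rfl)
      _ = _ := by ring
  exact absurd (h₃.trans_le (h₂.trans h₁)) (add_le_add h' h').not_gt

@[simp] theorem pair_inj {x y x' y' : M.N} : pair x y = pair x' y' ↔ x = x' ∧ y = y' := by
  refine ⟨fun h => ?_, fun h => by rw [h.1, h.2]⟩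
  rcases lt_trichotomy (x + y) (x' + y') with h' | h' | h'
  · exact absurd h (pair_lt_of_add_lt h').ne
  · have h₁ := pair_spec x y
    rw [h, pair_spec, h'] at h₁
    have := add_self_inj (add_left_cancel h₁)
    subst this
    exact ⟨add_right_cancel h', rfl⟩
  · exact absurd h (pair_lt_of_add_lt h').ne'

theorem pair_le_pair {x y x' y' : M.N} (h : x ≤ x') (h' : y ≤ y') : pair x y ≤ pair x' y' := by
  apply le_of_add_self_le
  rw [pair_spec, pair_spec]
  gcongr

theorem pair_lt_pair {x y x' y' : M.N} (h : x < x') (h' : y ≤ y') : pair x y < pair x' y' :=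
  lt_of_le_of_ne (pair_le_pair h.le h') fun heq => h.ne (pair_inj.1 heq).1

theorem pair_le_bound (x y : M.N) : pair x y ≤ (x + y + 1) * (x + y + 1) := by
  apply le_of_add_self_le
  rw [pair_spec]
  -- In the absence of subtraction, the difference of the two sides is added explicitly.
  calc (x + y) * (x + y + 1) + (y + y)
      ≤ (x + y) * (x + y + 1) + (y + y) + (x + (x + (x + y) * (x + y) + (x + y) + 1 + 1)) :=
        le_self_add
    _ = _ := by ring

/-- Components do not exceed their code. Hence the bounds $|X|$ in the formulas for tuple membership
exclude nothing, and intermediate codes can be bounded by the full code. -/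
theorem left_le_pair (x y : M.N) : x ≤ pair x y := by
  apply le_of_add_self_le
  rw [pair_spec]
  rcases eq_or_ne x 0 with h0 | h0
  · simp [h0]
  · obtain ⟨w, hw⟩ := exists_succ h0
    rw [← hw]
    calc w + 1 + (w + 1)
        ≤ w + 1 + (w + 1) + (w * w + w + w * y + y * (w + 1 + y + 1) + (y + y + y)) := le_self_add
      _ = _ := by ring

theorem right_le_pair (x y : M.N) : y ≤ pair x y := by
  apply le_of_add_self_le
  rw [pair_spec]
  exact le_add_self

end V1Model
end BA

namespace BA
namespace V1Model

variable {M : V1Model}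

/-! ## Sets of tuples -/

theorem lt_len {x : M.N} {X : M.S} : M.mem x X → x < M.len X := by
  simpa using M.sat _ .L1 (scons x e₀) (scons X s₀)

section Sat

variable (e : ℕ → M.N) (s : ℕ → M.S)

@[simp] theorem sat_isPair (a b c : Term) :
    M.Sat e s (isPair a b c) ↔ M.val e s c = pair (M.val e s a) (M.val e s b) :=
  eq_pair_iff

@[simp] theorem sat_mem2 (X : ℕ) (a b : Term) :
    M.Sat e s (mem2 X a b) ↔ M.mem (pair (M.val e s a) (M.val e s b)) (s X) := by
  simp only [mem2, sat_exLt, Str.sat_and, sat_isPair, Str.val_up, Str.val_var, scons_zero,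
    Str.sat_mem, Str.val_len]
  refine ⟨?_, fun h => ⟨_, lt_len h, rfl, h⟩⟩
  rintro ⟨_, -, rfl, h⟩
  exact h

@[simp] theorem sat_mem3 (X : ℕ) (a b c : Term) : M.Sat e s (mem3 X a b c) ↔
    M.mem (pair (pair (M.val e s a) (M.val e s b)) (M.val e s c)) (s X) := by
  simp only [mem3, sat_exLt, Str.sat_and, sat_isPair, Str.val_up, Str.val_var, scons_zero,
    sat_mem2, Str.val_len]
  refine ⟨?_, fun h => ⟨_, (left_le_pair _ _).trans_lt (lt_len h), rfl, h⟩⟩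
  rintro ⟨_, -, rfl, h⟩
  exact h

@[simp] theorem sat_mem4 (X : ℕ) (a b c d : Term) : M.Sat e s (mem4 X a b c d) ↔
    M.mem (pair (pair (pair (M.val e s a) (M.val e s b)) (M.val e s c)) (M.val e s d)) (s X) := by
  simp only [mem4, sat_exLt, Str.sat_and, sat_isPair, Str.val_up, Str.val_var, scons_zero,
    sat_mem3, Str.val_len]
  refine ⟨?_, fun h => ⟨_, ((left_le_pair _ _).trans (left_le_pair _ _)).trans_lt (lt_len h),
    rfl, h⟩⟩
  rintro ⟨_, -, rfl, h⟩
  exact h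

/-- The code of a quintuple. -/
noncomputable def tuple (t i j a b : M.N) : M.N := pair (pair (pair (pair t i) j) a) b

@[simp] theorem sat_mem5 (X : ℕ) (t i j a b : Term) : M.Sat e s (mem5 X t i j a b) ↔
    M.mem (tuple (M.val e s t) (M.val e s i) (M.val e s j) (M.val e s a) (M.val e s b)) (s X) := by
  simp only [mem5, sat_exLt, Str.sat_and, sat_isPair, Str.val_up, Str.val_var, scons_zero,
    sat_mem4, Str.val_len]
  refine ⟨?_, fun h => ⟨_, (((left_le_pair _ _).trans (left_le_pair _ _)).trans
    (left_le_pair _ _)).trans_lt (lt_len h), rfl, h⟩⟩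
  rintro ⟨_, -, rfl, h⟩
  exact h

@[simp] theorem sat_memEdge (X : ℕ) (i a j b : Term) : M.Sat e s (memEdge X i a j b) ↔
    M.mem (pair (pair (M.val e s i) (M.val e s a)) (pair (M.val e s j) (M.val e s b))) (s X) := by
  simp only [memEdge, sat_exLt, Str.sat_and, sat_isPair, Str.val_up, Str.val_var, scons_zero,
    sat_mem2, Str.val_len, scons_succ]
  refine ⟨?_, fun h => ⟨_, (left_le_pair _ _).trans_lt (lt_len h), _,
    (right_le_pair _ _).trans_lt (lt_len h), rfl, rfl, h⟩⟩
  rintro ⟨_, -, _, -, rfl, rfl, h⟩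
  exact h

end Sat

@[simp] theorem tuple_inj {t i j a b t' i' j' a' b' : M.N} :
    tuple t i j a b = tuple t' i' j' a' b' ↔ t = t' ∧ i = i' ∧ j = j' ∧ a = a' ∧ b = b' := by
  simp [tuple, and_assoc]

theorem tuple_lt_tuple {t i j a b t' i' j' a' b' : M.N} (ht : t < t') (hi : i ≤ i') (hj : j ≤ j')
    (ha : a ≤ a') (hb : b ≤ b') : tuple t i j a b < tuple t' i' j' a' b' :=
  pair_lt_pair (pair_lt_pair (pair_lt_pair (pair_lt_pair ht hi) hj) ha) hb

/-! ## Comprehension for sets of tuples -/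

theorem comp {φ : Fml} (hφ : Sigma0 φ) (e : ℕ → M.N) (s : ℕ → M.S) (x : M.N) :
    ∃ X, M.len X ≤ x ∧ ∀ y, M.mem y X ↔ y < x ∧ M.Sat (scons y e) s φ := by
  -- In the comprehension axiom number variable `1` is the bound `x`; the renumbering skips it, so
  -- that `φ` sees only `y` and the environment `e`.
  have := M.sat _ (V1.comp (hφ.subst (scons ♯0 fun k => ♯(k + 2)) id)) e s x
  simp only [Str.sat_exSLe, sat_allLt, Str.sat_iff, Str.sat_upS, Str.sat_subst, Str.val_var,
    scons_zero, Str.sat_mem] at this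
  obtain ⟨X, hX, h⟩ := this
  refine ⟨X, hX, fun y => ?_⟩
  have he : (fun k => M.val (scons y (scons x e)) s (scons ♯0 (fun k => ♯(k + 2)) k))
      = scons y e := by funext k; cases k <;> rfl
  constructor
  · intro hy
    have hyx := (lt_len hy).trans_le hX
    exact ⟨hyx, by have := (h y hyx).1 hy; rwa [he] at this⟩
  · rintro ⟨hyx, hy⟩
    refine (h y hyx).2 ?_
    rwa [he]

theorem comp_pair {φ : Fml} (hφ : Sigma0 φ) (e : ℕ → M.N) (s : ℕ → M.S) (n l : M.N) :
    ∃ X, M.len X ≤ pair n l ∧ ∀ z, M.mem z X ↔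
      ∃ i < n, ∃ a < l, z = pair i a ∧ M.Sat (scons a (scons i e)) s φ := by
  obtain ⟨X, hX, h⟩ := comp (φ := exLt ♯1 (exLt ♯3 (isPair ♯1 ♯0 ♯2 ∧ᶠ
      φ.subst (scons ♯0 (scons ♯1 fun k => ♯(k + 5))) id)))
    (.exLt _ (.exLt _ (.and (.isPair _ _ _) (hφ.subst _ _)))) (scons n (scons l e)) s (pair n l)
  have he : ∀ z i a, (fun k => M.val (scons a (scons i (scons z (scons n (scons l e))))) s
      (scons ♯0 (scons ♯1 fun k => ♯(k + 5)) k)) = scons a (scons i e) := by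
    intro z i a; funext k; rcases k with _ | _ | k <;> rfl
  simp only [Str.sat_subst, he, sat_exLt, Str.sat_and, sat_isPair, Str.val_var,
    scons_zero, scons_succ, id_eq] at h
  refine ⟨X, hX, fun z => (h z).trans ?_⟩
  constructor
  · rintro ⟨-, h⟩; exact h
  · rintro ⟨i, hi, a, ha, rfl, h⟩
    exact ⟨pair_lt_pair hi ha.le, i, hi, a, ha, rfl, h⟩

theorem comp_edge {φ : Fml} (hφ : Sigma0 φ) (e : ℕ → M.N) (s : ℕ → M.S) (n l : M.N) :
    ∃ X : M.S, ∀ z, M.mem z X ↔ ∃ i < n, ∃ j < n, ∃ a < l, ∃ b < l,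
      z = pair (pair i a) (pair j b) ∧
        M.Sat (scons b (scons a (scons j (scons i e)))) s φ := by
  -- The codes of the two endpoints are quantified below the code of the edge itself, so the
  -- decoding is $\Sigma^{1,b}_0$. The last shift moves the parameters of `φ` past the three
  -- auxiliary variables.
  obtain ⟨X, -, h⟩ := comp (φ := exLt ♯1 (exLt ♯2 (exLt ♯4 (exLt ♯5
      (exLe ♯4 (exLe ♯5 (isPair ♯5 ♯3 ♯1 ∧ᶠ isPair ♯4 ♯2 ♯0 ∧ᶠ isPair ♯1 ♯0 ♯6)) ∧ᶠ
      φ.subst (scons ♯0 (scons ♯1 (scons ♯2 (scons ♯3 fun k => ♯(k + 7))))) id)))))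
    (.exLt _ (.exLt _ (.exLt _ (.exLt _ (.and (.exLe _ (.exLe _ (.and (.isPair _ _ _)
      (.and (.isPair _ _ _) (.isPair _ _ _))))) (hφ.subst _ _))))))
    (scons n (scons l e)) s (pair (pair n l) (pair n l))
  have he : ∀ z i j a b, (fun k => M.val
      (scons b (scons a (scons j (scons i (scons z (scons n (scons l e))))))) s
      (scons ♯0 (scons ♯1 (scons ♯2 (scons ♯3 fun k => ♯(k + 7)))) k))
      = scons b (scons a (scons j (scons i e))) := by
    intro z i j a b; funext k; rcases k with _ | _ | _ | _ | k <;> rfl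
  simp only [Str.sat_subst, he, sat_exLt, Str.sat_exLe, Str.sat_and, sat_isPair, Str.val_var,
    scons_zero, scons_succ, id_eq] at h
  refine ⟨X, fun z => (h z).trans ?_⟩
  constructor
  · rintro ⟨-, i, hi, j, hj, a, ha, b, hb, ⟨_, -, _, -, rfl, rfl, rfl⟩, h⟩
    exact ⟨i, hi, j, hj, a, ha, b, hb, rfl, h⟩
  · rintro ⟨i, hi, j, hj, a, ha, b, hb, rfl, h⟩
    exact ⟨pair_lt_pair (pair_lt_pair hi ha.le) (pair_lt_pair hj hb.le).le,
      i, hi, j, hj, a, ha, b, hb,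
      ⟨_, left_le_pair _ _, _, right_le_pair _ _, rfl, rfl, rfl⟩, h⟩

/-- The length bound does not depend on `φ`, so sets obtained here can witness a bounded set
quantifier in an induction formula whose bound is fixed in advance. -/
theorem comp_tuple {φ : Fml} (hφ : Sigma0 φ) (e : ℕ → M.N) (s : ℕ → M.S) (q n l : M.N) :
    ∃ X, M.len X ≤ tuple q n n l l ∧ ∀ t < q, ∀ i < n, ∀ j < n, ∀ a < l, ∀ b < l,
      (M.mem (tuple t i j a b) X ↔
        M.Sat (scons b (scons a (scons j (scons i (scons t e))))) s φ) := by
  obtain ⟨X, hX, h⟩ := comp (φ := exLt ♯1 (exLt ♯3 (exLt ♯4 (exLt ♯6 (exLt ♯7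
      (exLe ♯5 (exLe ♯6 (exLe ♯7
        (isPair ♯7 ♯6 ♯2 ∧ᶠ isPair ♯2 ♯5 ♯1 ∧ᶠ isPair ♯1 ♯4 ♯0 ∧ᶠ isPair ♯0 ♯3 ♯8))) ∧ᶠ
      φ.subst (scons ♯0 (scons ♯1 (scons ♯2 (scons ♯3 (scons ♯4 fun k => ♯(k + 9)))))) id))))))
    (.exLt _ (.exLt _ (.exLt _ (.exLt _ (.exLt _ (.and (.exLe _ (.exLe _ (.exLe _
      (.and (.isPair _ _ _) (.and (.isPair _ _ _) (.and (.isPair _ _ _) (.isPair _ _ _)))))))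
      (hφ.subst _ _)))))))
    (scons q (scons n (scons l e))) s (tuple q n n l l)
  have he : ∀ z t i j a b, (fun k => M.val
      (scons b (scons a (scons j (scons i (scons t (scons z (scons q (scons n (scons l e))))))))) s
      (scons ♯0 (scons ♯1 (scons ♯2 (scons ♯3 (scons ♯4 fun k => ♯(k + 9))))) k))
      = scons b (scons a (scons j (scons i (scons t e)))) := by
    intro z t i j a b; funext k; rcases k with _ | _ | _ | _ | _ | k <;> rfl
  simp only [Str.sat_subst, he, sat_exLt, Str.sat_exLe, Str.sat_and, sat_isPair, Str.val_var,
    scons_zero, scons_succ, id_eq] at h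
  refine ⟨X, hX, fun t ht i hi j hj a ha b hb => (h _).trans ?_⟩
  constructor
  · rintro ⟨-, t', -, i', -, j', -, a', -, b', -, ⟨_, -, _, -, _, -, rfl, rfl, rfl, heq⟩, h⟩
    obtain ⟨rfl, rfl, rfl, rfl, rfl⟩ := tuple_inj.1 heq
    exact h
  · intro h
    exact ⟨tuple_lt_tuple ht hi.le hj.le ha.le hb.le, t, ht, i, hi, j, hj, a, ha, b, hb,
      ⟨_, (left_le_pair _ _).trans ((left_le_pair _ _).trans (left_le_pair _ _)),
        _, (left_le_pair _ _).trans (left_le_pair _ _), _, left_le_pair _ _,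
        rfl, rfl, rfl, rfl⟩, h⟩

end V1Model
end BA

namespace BA

/-! ## Instances inside a model -/

namespace Sigma0

theorem edge0 (Θ : Inst) (i j a b : Term) : Sigma0 (Θ.edge0 i j a b) :=
  and (and (mem2 _ _ _) (mem2 _ _ _)) (and (.imp (mem2 _ _ _) (memEdge _ _ _ _ _))
    (.imp (mem2 _ _ _) (memEdge _ _ _ _ _)))

theorem pr1 (Θ : Inst) (i a : Term) : Sigma0 (Θ.pr1 i a) :=
  and (mem2 _ _ _) (and
    (allLt _ (.imp (mem2 _ _ _) (exLt _ (and (mem2 _ _ _) (edge0 _ _ _ _ _)))))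
    (allLt _ (.imp (mem2 _ _ _) (exLt _ (and (mem2 _ _ _) (edge0 _ _ _ _ _))))))

theorem allEdge (Θ : Inst) {φ : Fml} (h : Sigma0 φ) : Sigma0 (Θ.allEdge φ) :=
  allLt _ (allLt _ (allLt _ (allLt _ h)))

theorem isPropagation (Θ : Inst) (E₁ R : ℕ) (q : Term) : Sigma0 (Θ.isPropagation E₁ R q) :=
  and (allEdge _ (iff (mem5 _ _ _ _ _ _) (memEdge _ _ _ _ _)))
    (.allLe _ (.imp (.le _ _) (allEdge _ (iff (mem5 _ _ _ _ _ _) (and (mem5 _ _ _ _ _ _)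
      (allLt _ (exLt _ (and (pr1 _ _ _) (and (mem5 _ _ _ _ _ _) (mem5 _ _ _ _ _ _))))))))))

theorem prcc (Θ : Inst) (R : ℕ) (t i a : Term) : Sigma0 (Θ.prcc R t i a) :=
  and (pr1 _ _ _) (and
    (allLt _ (.imp (mem2 _ _ _) (exLt _ (and (pr1 _ _ _) (mem5 _ _ _ _ _ _)))))
    (allLt _ (.imp (mem2 _ _ _) (exLt _ (and (pr1 _ _ _) (mem5 _ _ _ _ _ _))))))

end Sigma0

/-- The data of an instance in a model. -/
structure MInst (M : V1Model) where
  n : M.N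
  l : M.N
  VX : M.S
  EX : M.S
  V : M.S
  E : M.S

/-- The instance denoted by `Θ` in an environment. -/
def Inst.eval {M : V1Model} (Θ : Inst) (e : ℕ → M.N) (s : ℕ → M.S) : MInst M where
  n := M.val e s Θ.n
  l := M.val e s Θ.l
  VX := s Θ.VX
  EX := s Θ.EX
  V := s Θ.V
  E := s Θ.E

namespace MInst

open V1Model

variable {M : V1Model} (I : MInst M)

def withTarget (V' E' : M.S) : MInst M := { I with V := V', E := E' }

def Dom (i a : M.N) : Prop := M.mem (pair i a) I.V
def EdgeX (i j : M.N) : Prop := M.mem (pair i j) I.EX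
def Edge (i j a b : M.N) : Prop := M.mem (pair (pair i a) (pair j b)) I.E

structure IsInput : Prop where
  len_VX : M.len I.VX = I.n
  mem_VX : ∀ i < I.n, M.mem i I.VX
  mem_EX : ∀ z < M.len I.EX, M.mem z I.EX → ∃ i < I.n, ∃ j < I.n, z = pair i j

structure IsTarget : Prop where
  mem_V : ∀ z < M.len I.V, M.mem z I.V → ∃ i < I.n, ∃ a < I.l, z = pair i a
  mem_E : ∀ u < M.len I.E, ∀ v < M.len I.E, M.mem (pair u v) I.E →
    ∃ i < I.n, ∃ j < I.n, ∃ a < I.l, ∃ b < I.l,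
      u = pair i a ∧ v = pair j b ∧ I.Dom i a ∧ I.Dom j b

structure IsHom (m : M.N) (H : M.S) : Prop where
  total : ∀ i < M.len I.VX, M.mem i I.VX → ∃ z < M.len I.V, M.mem z I.V ∧ M.mem (pair i z) H
  unique : ∀ i < M.len I.VX, M.mem i I.VX → ∀ z < M.len I.V, M.mem z I.V →
    ∀ w < M.len I.V, M.mem w I.V → M.mem (pair i z) H ∧ M.mem (pair i w) H → z = w
  dom : ∀ i < I.n, ∀ z < m, M.mem (pair i z) H → ∃ a < I.l, z = pair i a ∧ I.Dom i a
  edge : ∀ i < I.n, ∀ j < I.n, ∀ z < m, ∀ w < m,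
    I.EdgeX i j ∧ M.mem (pair i z) H ∧ M.mem (pair j w) H → M.mem (pair z w) I.E

def HasSolution : Prop :=
  ∃ H, M.len H ≤ pair I.n (pair I.n I.l) ∧ I.IsHom (pair I.n I.l) H

def Edge0 (i j a b : M.N) : Prop :=
  (I.Dom i a ∧ I.Dom j b) ∧ (I.EdgeX i j → I.Edge i j a b) ∧ (I.EdgeX j i → I.Edge j i b a)

def Pr1 (i a : M.N) : Prop :=
  I.Dom i a ∧ (∀ j < I.n, I.EdgeX i j → ∃ b < I.l, I.Dom j b ∧ I.Edge0 i j a b) ∧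
    (∀ k < I.n, I.EdgeX k i → ∃ c < I.l, I.Dom k c ∧ I.Edge0 k i c a)

def AllEdge (P : M.N → M.N → M.N → M.N → Prop) : Prop :=
  ∀ i < I.n, ∀ j < I.n, ∀ a < I.l, ∀ b < I.l, P i j a b

structure IsR1 (V₁ E₁ : M.S) : Prop where
  isTarget : (I.withTarget V₁ E₁).IsTarget
  mem_V : ∀ i < I.n, ∀ a < I.l, (M.mem (pair i a) V₁ ↔ I.Pr1 i a)
  mem_E : I.AllEdge fun i j a b => M.mem (pair (pair i a) (pair j b)) E₁ ↔
    I.Pr1 i a ∧ I.Pr1 j b ∧ I.Edge0 i j a b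

def Step (R : M.S) (t i j a b : M.N) : Prop :=
  M.mem (tuple t i j a b) R ∧ ∀ k < I.n, ∃ c < I.l, I.Pr1 k c ∧
    M.mem (tuple t i k a c) R ∧ M.mem (tuple t k j c b) R

structure IsPropagation (E₁ R : M.S) (q : M.N) : Prop where
  base : I.AllEdge fun i j a b =>
    M.mem (tuple 1 i j a b) R ↔ M.mem (pair (pair i a) (pair j b)) E₁
  step : ∀ t ≤ q, 1 ≤ t → I.AllEdge fun i j a b =>
    M.mem (tuple (t + 1) i j a b) R ↔ I.Step R t i j a b

def PrCC (R : M.S) (t i a : M.N) : Prop :=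
  I.Pr1 i a ∧ (∀ j < I.n, I.EdgeX i j → ∃ b < I.l, I.Pr1 j b ∧ M.mem (tuple t i j a b) R) ∧
    (∀ k < I.n, I.EdgeX k i → ∃ c < I.l, I.Pr1 k c ∧ M.mem (tuple t k i c a) R)

structure IsFinal (R : M.S) (t : M.N) (V' E' : M.S) : Prop where
  isTarget : (I.withTarget V' E').IsTarget
  mem_V : ∀ i < I.n, ∀ a < I.l, (M.mem (pair i a) V' ↔ I.PrCC R t i a)
  mem_E : I.AllEdge fun i j a b => M.mem (pair (pair i a) (pair j b)) E' ↔
    (I.PrCC R t i a ∧ I.PrCC R t j b) ∧ M.mem (tuple t i j a b) R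

end MInst

namespace V1Model

variable {M : V1Model}

/-- `C` restricted to `{0, …, z}` is the census function of `X`. -/
structure IsCensus (X C : M.S) (z : M.N) : Prop where
  total : ∀ x ≤ z, ∃ y ≤ z, M.mem (pair x y) C ∧ ∀ y' ≤ z, M.mem (pair x y') C → y' = y
  zero : M.mem (pair 0 0) C
  succ : ∀ x < z, ∀ y ≤ z, M.mem (pair x y) C →
    (M.mem x X → M.mem (pair (x + 1) (y + 1)) C) ∧ (¬ M.mem x X → M.mem (pair (x + 1) y) C)

end V1Model

namespace MInst

open V1Model

variable {M : V1Model} (I : MInst M)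

def IsCC (V' E' : M.S) : Prop :=
  ∃ V₁ E₁ C R, I.IsR1 V₁ E₁ ∧ IsCensus E₁ C (M.len E₁) ∧
    ∃ q ≤ M.len E₁, M.mem (pair (M.len E₁) q) C ∧ I.IsPropagation E₁ R q ∧
      I.IsFinal R (q + 1) V' E'

end MInst

-- Truth of the instance formulas in a model

namespace Inst

open V1Model

variable {M : V1Model} (Θ : Inst) (e : ℕ → M.N) (s : ℕ → M.S)

@[simp] theorem eval_up (x : M.N) : Θ.up.eval (scons x e) s = Θ.eval e s := by
  simp [eval, up]
@[simp] theorem eval_upS (X : M.S) : Θ.upS.eval e (scons X s) = Θ.eval e s := by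
  simp [eval, upS]
@[simp] theorem eval_withTarget (V' E' : ℕ) :
    (Θ.withTarget V' E').eval e s = (Θ.eval e s).withTarget (s V') (s E') := rfl

theorem val_n : M.val e s Θ.n = (Θ.eval e s).n := rfl
theorem val_l : M.val e s Θ.l = (Θ.eval e s).l := rfl

@[simp] theorem sat_dom (i a : Term) :
    M.Sat e s (Θ.dom i a) ↔ (Θ.eval e s).Dom (M.val e s i) (M.val e s a) := sat_mem2 ..
@[simp] theorem sat_edgeX (i j : Term) :
    M.Sat e s (Θ.edgeX i j) ↔ (Θ.eval e s).EdgeX (M.val e s i) (M.val e s j) := sat_mem2 ..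
@[simp] theorem sat_edge (i j a b : Term) : M.Sat e s (Θ.edge i j a b) ↔
    (Θ.eval e s).Edge (M.val e s i) (M.val e s j) (M.val e s a) (M.val e s b) := sat_memEdge ..

/-- Domains and input edges read only the set variables of an instance; therefore `pr1` and `prcc`
may use them unweakened below number quantifiers. -/
theorem dom_eval (e' : ℕ → M.N) : (Θ.eval e' s).Dom = (Θ.eval e s).Dom := rfl
theorem edgeX_eval (e' : ℕ → M.N) : (Θ.eval e' s).EdgeX = (Θ.eval e s).EdgeX := rfl

@[simp] theorem sat_edge0 (i j a b : Term) : M.Sat e s (Θ.edge0 i j a b) ↔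
    (Θ.eval e s).Edge0 (M.val e s i) (M.val e s j) (M.val e s a) (M.val e s b) := by
  simp [edge0, MInst.Edge0]

@[simp] theorem sat_pr1 (i a : Term) :
    M.Sat e s (Θ.pr1 i a) ↔ (Θ.eval e s).Pr1 (M.val e s i) (M.val e s a) := by
  simp [pr1, MInst.Pr1, dom_eval Θ e, edgeX_eval Θ e, val_n, val_l]

@[simp] theorem sat_isInput : M.Sat e s Θ.isInput ↔ (Θ.eval e s).IsInput := by
  simp only [isInput, Str.sat_and, Str.sat_eqN, sat_allLt, sat_exLt, Str.sat_mem, Str.sat_imp,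
    sat_isPair, Str.val_up, Str.val_len, Str.val_var, scons_zero, scons_succ]
  exact ⟨fun ⟨a, b, c⟩ => ⟨a, b, c⟩, fun ⟨a, b, c⟩ => ⟨a, b, c⟩⟩

@[simp] theorem sat_isTarget : M.Sat e s Θ.isTarget ↔ (Θ.eval e s).IsTarget := by
  simp only [isTarget, Str.sat_and, sat_allLt, sat_exLt, Str.sat_mem, Str.sat_imp, sat_dom,
    sat_isPair, sat_mem2, val_n, val_l, eval_up, Str.val_up, Str.val_len, Str.val_var, scons_zero,
    scons_succ]
  exact ⟨fun ⟨a, b⟩ => ⟨a, b⟩, fun ⟨a, b⟩ => ⟨a, b⟩⟩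

@[simp] theorem sat_isHom (m : Term) (H : ℕ) :
    M.Sat e s (Θ.isHom m H) ↔ (Θ.eval e s).IsHom (M.val e s m) (s H) := by
  simp only [isHom, Str.sat_and, sat_allLt, sat_exLt, Str.sat_mem, Str.sat_imp, sat_dom,
    Str.sat_eqN, sat_edgeX, sat_isPair, sat_mem2, val_n, val_l, eval_up, Str.val_up, Str.val_len,
    Str.val_var, scons_zero, scons_succ]
  exact ⟨fun ⟨a, b, c, d⟩ => ⟨a, b, c, d⟩, fun ⟨a, b, c, d⟩ => ⟨a, b, c, d⟩⟩

-- By `pair_le_bound` the number quantifiers are wide enough to reach the actual codes, so they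
-- merely name $\langle n,l\rangle$ and $\langle n,\langle n,l\rangle\rangle$.
@[simp] theorem sat_hasSolution :
    M.Sat e s Θ.hasSolution ↔ (Θ.eval e s).HasSolution := by
  simp only [hasSolution, pairBound, Str.sat_exLe, Str.sat_and, sat_isPair, Str.sat_exSLe,
    sat_isHom, eval_upS, val_n, val_l, eval_up, Str.val_add, Str.val_mul,
    Str.val_one, Str.val_var, scons_zero, scons_succ]
  constructor
  · rintro ⟨_, -, _, -, rfl, rfl, h⟩
    exact h
  · intro h
    exact ⟨_, pair_le_bound _ _, _, pair_le_bound _ _, rfl, rfl, h⟩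

@[simp] theorem sat_allEdge (φ : Fml) : M.Sat e s (Θ.allEdge φ) ↔
    (Θ.eval e s).AllEdge fun i j a b =>
      M.Sat (scons b (scons a (scons j (scons i e)))) s φ := by
  simp only [allEdge, MInst.AllEdge, sat_allLt, val_n, val_l, eval_up]

@[simp] theorem sat_allVert (φ : Fml) : M.Sat e s (Θ.allVert φ) ↔
    ∀ i < (Θ.eval e s).n, ∀ a < (Θ.eval e s).l, M.Sat (scons a (scons i e)) s φ := by
  simp only [allVert, sat_allLt, val_n, val_l, eval_up]

@[simp] theorem sat_isR1 (V₁ E₁ : ℕ) :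
    M.Sat e s (Θ.isR1 V₁ E₁) ↔ (Θ.eval e s).IsR1 (s V₁) (s E₁) := by
  simp only [isR1, Str.sat_and, sat_isTarget, eval_withTarget, sat_allVert, sat_allEdge,
    Str.sat_iff, sat_mem2, sat_memEdge, sat_pr1, sat_edge0, eval_up, Str.val_var, scons_zero,
    scons_succ]
  exact ⟨fun ⟨a, b, c⟩ => ⟨a, b, c⟩, fun ⟨a, b, c⟩ => ⟨a, b, c⟩⟩

@[simp] theorem sat_isPropagation (E₁ R : ℕ) (q : Term) :
    M.Sat e s (Θ.isPropagation E₁ R q) ↔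
      (Θ.eval e s).IsPropagation (s E₁) (s R) (M.val e s q) := by
  simp only [isPropagation, Str.sat_and, sat_allEdge, sat_allLt, sat_exLt, Str.sat_allLe,
    Str.sat_imp, Str.sat_le, Str.sat_iff, sat_mem5, sat_memEdge, sat_pr1, val_n, val_l, eval_up,
    Str.val_add, Str.val_one, Str.val_var, scons_zero, scons_succ]
  exact ⟨fun ⟨a, b⟩ => ⟨a, b⟩, fun ⟨a, b⟩ => ⟨a, b⟩⟩

@[simp] theorem sat_prcc (R : ℕ) (t i a : Term) : M.Sat e s (Θ.prcc R t i a) ↔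
    (Θ.eval e s).PrCC (s R) (M.val e s t) (M.val e s i) (M.val e s a) := by
  simp only [prcc, MInst.PrCC, Str.sat_and, sat_allLt, sat_exLt, Str.sat_imp, sat_mem5, sat_pr1,
    sat_edgeX, edgeX_eval Θ e, val_n, val_l, eval_up, Str.val_up, Str.val_var, scons_zero,
    scons_succ]

@[simp] theorem sat_isFinal (R : ℕ) (t : Term) (V' E' : ℕ) : M.Sat e s (Θ.isFinal R t V' E') ↔
    (Θ.eval e s).IsFinal (s R) (M.val e s t) (s V') (s E') := by
  simp only [isFinal, Str.sat_and, sat_isTarget, eval_withTarget, sat_allVert, sat_allEdge,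
    Str.sat_iff, sat_mem2, sat_memEdge, sat_mem5, sat_prcc, eval_up, Str.val_up, Str.val_var,
    scons_zero, scons_succ]
  exact ⟨fun ⟨a, b, c⟩ => ⟨a, b, c⟩, fun ⟨a, b, c⟩ => ⟨a, b, c⟩⟩

theorem sat_census (X C : ℕ) :
    M.Sat e s (census X C) ↔ IsCensus (s X) (s C) (M.len (s X)) := by
  simp only [census, Str.sat_and, Str.sat_allLe, Str.sat_exLe, sat_allLt, Str.sat_imp, sat_mem2,
    Str.sat_neg, Str.sat_mem, Str.sat_eqN, Str.val_len, Str.val_add, Str.val_one, Str.val_zero,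
    Str.val_var, scons_zero, scons_succ]
  exact ⟨fun ⟨a, b, c⟩ => ⟨a, b, c⟩, fun ⟨a, b, c⟩ => ⟨a, b, c⟩⟩

@[simp] theorem sat_isCC (V' E' : ℕ) :
    M.Sat e s (Θ.isCC V' E') ↔ (Θ.eval e s).IsCC (s V') (s E') := by
  simp only [isCC, MInst.IsCC, Str.sat_exS, Str.sat_and, sat_isR1, sat_census, Str.sat_exLe,
    sat_mem2, sat_isPropagation, sat_isFinal, eval_up, eval_upS, Str.val_len, Str.val_add,
    Str.val_one, Str.val_var, scons_zero, scons_succ]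

end Inst

end BA

namespace BA

open V1Model

/-! ## Existence of the census function -/

/-- `C` restricted to `{0, …, z}` is the census function of `X`, and it is below the identity. -/
def censusUpTo (X C : ℕ) (z : Term) : Fml :=
  allLe z (exLe z.up
    (mem2 C ♯1 ♯0 ∧ᶠ allLe z.up.up (mem2 C ♯2 ♯0 →ᶠ ♯0 =ᶠ ♯1))) ∧ᶠ
  mem2 C .zero .zero ∧ᶠ
  allLt z (allLe z.up (mem2 C ♯1 ♯0 →ᶠ
    (♯1 ∈ᶠ X →ᶠ mem2 C (♯1 +ᶠ .one) (♯0 +ᶠ .one)) ∧ᶠ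
    (¬ᶠ(♯1 ∈ᶠ X) →ᶠ mem2 C (♯1 +ᶠ .one) ♯0))) ∧ᶠ
  allLe z (allLe z.up (mem2 C ♯1 ♯0 →ᶠ ♯0 ≤ᶠ ♯1))

theorem Sigma0.censusUpTo (X C : ℕ) (z : Term) : Sigma0 (censusUpTo X C z) :=
  and (.allLe _ (.exLe _ (and (mem2 _ _ _) (.allLe _ (.imp (mem2 _ _ _) (.eqN _ _))))))
    (and (mem2 _ _ _) (and (allLt _ (.allLe _ (.imp (mem2 _ _ _)
      (and (.imp (.mem _ _) (mem2 _ _ _)) (.imp (neg (.mem _ _)) (mem2 _ _ _))))))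
      (.allLe _ (.allLe _ (.imp (mem2 _ _ _) (.le _ _))))))

namespace V1Model

variable {M : V1Model}

theorem sat_censusUpTo (e : ℕ → M.N) (s : ℕ → M.S) (X C : ℕ) (z : Term) :
    M.Sat e s (censusUpTo X C z) ↔ IsCensus (s X) (s C) (M.val e s z) ∧
      ∀ x ≤ M.val e s z, ∀ y ≤ M.val e s z, M.mem (pair x y) (s C) → y ≤ x := by
  simp only [censusUpTo, Str.sat_and, Str.sat_allLe, Str.sat_exLe, sat_allLt, Str.sat_imp,
    sat_mem2, Str.sat_neg, Str.sat_mem, Str.sat_eqN, Str.sat_le, Str.val_up, Str.val_add,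
    Str.val_one, Str.val_zero, Str.val_var, scons_zero, scons_succ]
  exact ⟨fun ⟨a, b, c, d⟩ => ⟨⟨a, b, c⟩, d⟩, fun ⟨⟨a, b, c⟩, d⟩ => ⟨a, b, c, d⟩⟩

/-- `C` is cut down to arguments and values at most `z`, since stray pairs outside that square could
destroy uniqueness, and the value at `z + 1` is added. The length bound depends on `N` but not on
`z`, as the induction requires. -/
theorem exists_isCensus_succ (X C : M.S) {N z : M.N} (hz : z + 1 ≤ N) (hC : IsCensus X C z)
    (hle : ∀ x ≤ z, ∀ y ≤ z, M.mem (pair x y) C → y ≤ x) :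
    ∃ C', M.len C' ≤ pair (N + 1) (N + 1) ∧ IsCensus X C' (z + 1) ∧
      ∀ x ≤ z + 1, ∀ y ≤ z + 1, M.mem (pair x y) C' → y ≤ x := by
  obtain ⟨C', hlen, h⟩ := comp_pair (φ := (♯1 ≤ᶠ ♯2 ∧ᶠ ♯0 ≤ᶠ ♯2 ∧ᶠ mem2 0 ♯1 ♯0) ∨ᶠ
      (♯1 =ᶠ ♯2 +ᶠ .one ∧ᶠ exLe ♯2 (mem2 0 ♯3 ♯0 ∧ᶠ
        ((♯3 ∈ᶠ 1 ∧ᶠ ♯1 =ᶠ ♯0 +ᶠ .one) ∨ᶠ (¬ᶠ(♯3 ∈ᶠ 1) ∧ᶠ ♯1 =ᶠ ♯0)))))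
    (.or (.and (.le _ _) (.and (.le _ _) (.mem2 _ _ _))) (.and (.eqN _ _) (.exLe _
      (.and (.mem2 _ _ _) (.or (.and (.mem _ _) (.eqN _ _)) (.and (.neg (.mem _ _)) (.eqN _ _)))))))
    (scons z e₀) (scons C (scons X s₀)) (N + 1) (N + 1)
  simp only [Str.sat_or, Str.sat_and, Str.sat_le, Str.sat_exLe, sat_mem2, Str.sat_neg, Str.sat_mem,
    Str.sat_eqN, Str.val_add, Str.val_one, Str.val_var, scons_zero, scons_succ] at h
  have h' : ∀ x ≤ z + 1, ∀ y ≤ z + 1, (M.mem (pair x y) C' ↔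
      (x ≤ z ∧ y ≤ z ∧ M.mem (pair x y) C) ∨ (x = z + 1 ∧ ∃ y₀ ≤ z, M.mem (pair z y₀) C ∧
        ((M.mem z X ∧ y = y₀ + 1) ∨ (¬ M.mem z X ∧ y = y₀)))) := by
    intro x hx y hy
    rw [h]
    constructor
    · rintro ⟨_, -, _, -, heq, h⟩
      obtain ⟨rfl, rfl⟩ := pair_inj.1 heq
      exact h
    · exact fun h => ⟨x, lt_succ_iff.2 (hx.trans hz), y, lt_succ_iff.2 (hy.trans hz), rfl, h⟩
  have hzz : ¬ z + 1 ≤ z := fun h => (succ_le_iff.1 h).false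
  have hz1 : z ≤ z + 1 := le_self_add
  have hold : ∀ x ≤ z, ∀ y ≤ z + 1, (M.mem (pair x y) C' ↔ y ≤ z ∧ M.mem (pair x y) C) := by
    intro x hx y hy
    rw [h' x (hx.trans hz1) y hy]
    constructor
    · rintro (h | ⟨rfl, -⟩)
      · exact h.2
      · exact (hzz hx).elim
    · exact fun h => .inl ⟨hx, h⟩
  have hnew : ∀ y ≤ z + 1, (M.mem (pair (z + 1) y) C' ↔ ∃ y₀ ≤ z, M.mem (pair z y₀) C ∧
      ((M.mem z X ∧ y = y₀ + 1) ∨ (¬ M.mem z X ∧ y = y₀))) := by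
    intro y hy
    rw [h' _ le_rfl y hy]
    constructor
    · rintro (h | ⟨-, h⟩)
      · exact (hzz h.1).elim
      · exact h
    · exact fun h => .inr ⟨rfl, h⟩
  have hcase : ∀ x ≤ z + 1, x ≤ z ∨ x = z + 1 := fun x hx =>
    hx.lt_or_eq.imp_left lt_succ_iff.1
  refine ⟨C', hlen, ⟨fun x hx => ?_, ?_, fun x hx y hy hxy => ?_⟩, fun x hx y hy hxy => ?_⟩
  · rcases hcase x hx with hx | rfl
    · obtain ⟨y, hy, hm, huniq⟩ := hC.total x hx
      refine ⟨y, hy.trans hz1, (hold x hx y (hy.trans hz1)).2 ⟨hy, hm⟩, fun y' hy' hm' => ?_⟩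
      obtain ⟨h₁, h₂⟩ := (hold x hx y' hy').1 hm'
      exact huniq y' h₁ h₂
    · obtain ⟨y, hy, hm, huniq⟩ := hC.total z le_rfl
      by_cases hX : M.mem z X
      · have hy1 : y + 1 ≤ z + 1 := by gcongr
        refine ⟨y + 1, hy1, (hnew _ hy1).2 ⟨y, hy, hm, .inl ⟨hX, rfl⟩⟩, fun y' hy' hm' => ?_⟩
        obtain ⟨y₀, hy₀, hm₀, h | h⟩ := (hnew y' hy').1 hm'
        · rw [h.2, huniq y₀ hy₀ hm₀]
        · exact (h.1 hX).elim
      · have hy1 : y ≤ z + 1 := hy.trans hz1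
        refine ⟨y, hy1, (hnew _ hy1).2 ⟨y, hy, hm, .inr ⟨hX, rfl⟩⟩, fun y' hy' hm' => ?_⟩
        obtain ⟨y₀, hy₀, hm₀, h | h⟩ := (hnew y' hy').1 hm'
        · exact (hX h.1).elim
        · rw [h.2, huniq y₀ hy₀ hm₀]
  · exact (hold 0 zero_le 0 zero_le).2 ⟨zero_le, hC.zero⟩
  · have hx := lt_succ_iff.1 hx
    obtain ⟨hyz, hm⟩ := (hold x hx y hy).1 hxy
    rcases hx.lt_or_eq with hlt | rfl
    · have hyx := hle x hx y hyz hm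
      have hx1 := succ_le_iff.2 hlt
      -- Here staying below the identity is needed: the next value `y + 1` is at most `x + 1 ≤ z`,
      -- so it survives the cut.
      have hy1 : y + 1 ≤ z := le_trans (by gcongr) hx1
      obtain ⟨h₁, h₂⟩ := hC.succ x hlt y hyz hm
      exact ⟨fun hX => (hold _ hx1 _ (hy1.trans hz1)).2 ⟨hy1, h₁ hX⟩,
        fun hX => (hold _ hx1 _ hy).2 ⟨hyz, h₂ hX⟩⟩
    · exact ⟨fun hX => (hnew _ (by gcongr)).2 ⟨y, hyz, hm, .inl ⟨hX, rfl⟩⟩,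
        fun hX => (hnew _ hy).2 ⟨y, hyz, hm, .inr ⟨hX, rfl⟩⟩⟩
  · rcases hcase x hx with hx | rfl
    · obtain ⟨hyz, hm⟩ := (hold x hx y hy).1 hxy
      exact hle x hx y hyz hm
    · exact hy

/-- Induction on `z` for the $\Sigma^{1,b}_1$ statement that, if `z ≤ N`, some set of length at most
$\langle N+1,N+1\rangle$ codes the census function up to `z`. -/
theorem exists_isCensus (X : M.S) (N : M.N) : ∃ C, IsCensus X C N := by
  have := ind (φ := ♯0 ≤ᶠ ♯1 →ᶠ exSLe ♯2 (censusUpTo 1 0 ♯0))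
    (.imp (.of0 (.le _ _)) (.exSLe _ (.of0 (.censusUpTo _ _ _))))
    (scons N (scons (pair (N + 1) (N + 1)) e₀)) (scons X s₀) ?_ (fun z ih => ?_) N
  · simp only [Str.sat_imp, Str.sat_le, Str.sat_exSLe, sat_censusUpTo, Str.val_var, scons_zero,
      scons_succ] at this
    obtain ⟨C, -, hC, -⟩ := this le_rfl
    exact ⟨C, hC⟩
  · simp only [Str.sat_imp, Str.sat_le, Str.sat_exSLe, sat_censusUpTo, Str.val_var, scons_zero,
      scons_succ]
    intro hN
    obtain ⟨C, hlen, h⟩ := comp_pair (φ := ♯1 =ᶠ .zero ∧ᶠ ♯0 =ᶠ .zero)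
      (.and (.eqN _ _) (.eqN _ _)) e₀ s₀ (N + 1) (N + 1)
    simp only [Str.sat_and, Str.sat_eqN, Str.val_zero, Str.val_var, scons_zero, scons_succ] at h
    have h0 : M.mem (pair 0 0) C :=
      (h _).2 ⟨0, lt_succ_iff.2 hN, 0, lt_succ_iff.2 hN, rfl, rfl, rfl⟩
    refine ⟨C, hlen, ⟨fun x hx => ⟨0, le_rfl, ?_, fun y hy _ => nonpos_iff_eq_zero.1 hy⟩, h0,
      fun x hx => (not_lt_zero hx).elim⟩, fun x hx y hy _ => hy.trans zero_le⟩
    rwa [nonpos_iff_eq_zero.1 hx]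
  · simp only [Str.sat_imp, Str.sat_le, Str.sat_exSLe, sat_censusUpTo, Str.val_var, scons_zero,
      scons_succ] at ih ⊢
    intro hz
    obtain ⟨C, -, hC, hle⟩ := ih (le_self_add.trans hz)
    exact exists_isCensus_succ X C hz hC hle

end V1Model

/-! ## Existence of the cycle-consistency reduction -/

namespace MInst

variable {M : V1Model} (I : MInst M)

/-- An instance whose parameters are the first number and set variables. -/
def generic : Inst := ⟨♯1, ♯0, 3, 2, 1, 0⟩

/-- The environment in which `generic` denotes `I`. -/
def envN : ℕ → M.N := scons I.l (scons I.n e₀)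
def envS : ℕ → M.S := scons I.E (scons I.V (scons I.EX (scons I.VX s₀)))

/-- Comprehension and induction take formulas, so an instance of the model has to be named
syntactically; this one name, with suitable environments, serves for every instance. -/
theorem eval_generic : generic.eval I.envN I.envS = I := rfl

/-- A digraph given by `Σ^{1,b}_0`-definable vertices and edges exists. -/
theorem exists_target {φ ψ : Fml} (hφ : Sigma0 φ) (hψ : Sigma0 ψ) (e : ℕ → M.N) (s : ℕ → M.S)
    (h : ∀ i j a b, M.Sat (scons b (scons a (scons j (scons i e)))) s ψ →
      M.Sat (scons a (scons i e)) s φ ∧ M.Sat (scons b (scons j e)) s φ) :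
    ∃ V' E' : M.S, (I.withTarget V' E').IsTarget ∧
      (∀ i < I.n, ∀ a < I.l, (M.mem (pair i a) V' ↔ M.Sat (scons a (scons i e)) s φ)) ∧
      I.AllEdge fun i j a b => M.mem (pair (pair i a) (pair j b)) E' ↔
        M.Sat (scons b (scons a (scons j (scons i e)))) s ψ := by
  obtain ⟨V', -, hV⟩ := comp_pair hφ e s I.n I.l
  obtain ⟨E', hE⟩ := comp_edge hψ e s I.n I.l
  have hV' : ∀ i < I.n, ∀ a < I.l,
      (M.mem (pair i a) V' ↔ M.Sat (scons a (scons i e)) s φ) := by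
    intro i hi a ha
    rw [hV]
    constructor
    · rintro ⟨_, -, _, -, heq, h⟩
      obtain ⟨rfl, rfl⟩ := pair_inj.1 heq
      exact h
    · exact fun h => ⟨i, hi, a, ha, rfl, h⟩
  refine ⟨V', E', ⟨fun z _ hz => ?_, fun u _ v _ huv => ?_⟩, hV', fun i hi j hj a ha b hb => ?_⟩
  · obtain ⟨i, hi, a, ha, rfl, -⟩ := (hV z).1 hz
    exact ⟨i, hi, a, ha, rfl⟩
  · obtain ⟨i, hi, j, hj, a, ha, b, hb, heq, hs⟩ := (hE _).1 huv
    obtain ⟨rfl, rfl⟩ := pair_inj.1 heq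
    exact ⟨i, hi, j, hj, a, ha, b, hb, rfl, rfl, (hV' i hi a ha).2 (h i j a b hs).1,
      (hV' j hj b hb).2 (h i j a b hs).2⟩
  · refine (hE _).trans ⟨?_, fun h => ⟨i, hi, j, hj, a, ha, b, hb, rfl, h⟩⟩
    rintro ⟨_, -, _, -, _, -, _, -, heq, h⟩
    simp only [pair_inj] at heq
    obtain ⟨⟨rfl, rfl⟩, rfl, rfl⟩ := heq
    exact h

theorem exists_isR1 : ∃ V₁ E₁, I.IsR1 V₁ E₁ := by
  obtain ⟨V₁, E₁, h⟩ := I.exists_target (φ := generic.up.up.pr1 ♯1 ♯0)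
    (ψ := generic.up.up.up.up.pr1 ♯3 ♯1 ∧ᶠ generic.up.up.up.up.pr1 ♯2 ♯0 ∧ᶠ
      generic.up.up.up.up.edge0 ♯3 ♯2 ♯1 ♯0)
    (.pr1 _ _ _) (.and (.pr1 _ _ _) (.and (.pr1 _ _ _) (.edge0 _ _ _ _ _))) I.envN I.envS
    (fun i j a b h => by simp at h ⊢; exact ⟨h.1, h.2.1⟩)
  simp only [Str.sat_and, Inst.sat_pr1, Inst.sat_edge0, Inst.eval_up, eval_generic, Str.val_var,
    scons_zero, scons_succ] at h
  exact ⟨V₁, E₁, h.1, h.2.1, h.2.2⟩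

theorem exists_isFinal (R : M.S) (t : M.N) : ∃ V' E', I.IsFinal R t V' E' := by
  obtain ⟨V', E', h⟩ := I.exists_target
    (φ := generic.upS.up.up.up.prcc 0 ♯2 ♯1 ♯0)
    (ψ := (generic.upS.up.up.up.up.up.prcc 0 ♯4 ♯3 ♯1 ∧ᶠ
      generic.upS.up.up.up.up.up.prcc 0 ♯4 ♯2 ♯0) ∧ᶠ mem5 0 ♯4 ♯3 ♯2 ♯1 ♯0)
    (.prcc _ _ _ _ _) (.and (.and (.prcc _ _ _ _ _) (.prcc _ _ _ _ _)) (.mem5 _ _ _ _ _ _))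
    (scons t I.envN) (scons R I.envS)
    (fun i j a b h => by simp at h ⊢; exact h.1)
  simp only [Str.sat_and, Inst.sat_prcc, sat_mem5, Inst.eval_up, Inst.eval_upS, eval_generic,
    Str.val_var, scons_zero, scons_succ] at h
  exact ⟨V', E', h.1, h.2.1, h.2.2⟩

/-- A step reads only stage `t`, and only at vertices and values within range, where comprehension
controls the sets. -/
theorem Step.congr {R R' : M.S} {t : M.N}
    (h : I.AllEdge fun i j a b => M.mem (tuple t i j a b) R ↔ M.mem (tuple t i j a b) R') :
    I.AllEdge fun i j a b => I.Step R t i j a b ↔ I.Step R' t i j a b := by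
  intro i hi j hj a ha b hb
  refine and_congr (h i hi j hj a ha b hb) (forall₂_congr fun k hk => exists_congr fun c =>
    and_congr_right fun hc => and_congr_right fun _ => and_congr ?_ ?_)
  · exact h i hi k hk a ha c hc
  · exact h k hk j hj c hc b hb

/-- A propagation of length `t` carries the stages $1,\dots,t+1$. These are copied, and stage $t+2$
is defined by the recursion from stage $t+1$. As $t+2\le q+1$, all stage indices lie below `q + 1 +
1`, the first component of the length bound. -/
theorem exists_isPropagation_succ {E₁ R : M.S} {q t : M.N} (ht : t + 1 ≤ q)
    (hR : I.IsPropagation E₁ R t) :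
    ∃ R', M.len R' ≤ tuple (q + 1 + 1) I.n I.n I.l I.l ∧ I.IsPropagation E₁ R' (t + 1) := by
  obtain ⟨R', hlen, h⟩ := comp_tuple (φ := (♯4 ≤ᶠ ♯5 +ᶠ .one ∧ᶠ mem5 0 ♯4 ♯3 ♯2 ♯1 ♯0) ∨ᶠ
      (♯4 =ᶠ ♯5 +ᶠ .one +ᶠ .one ∧ᶠ mem5 0 (♯5 +ᶠ .one) ♯3 ♯2 ♯1 ♯0 ∧ᶠ
        allLt ♯7 (exLt ♯7 (generic.upS.up.up.up.up.up.up.up.up.pr1 ♯1 ♯0 ∧ᶠ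
          mem5 0 (♯7 +ᶠ .one) ♯5 ♯1 ♯3 ♯0 ∧ᶠ mem5 0 (♯7 +ᶠ .one) ♯1 ♯4 ♯0 ♯2))))
    (.or (.and (.le _ _) (.mem5 _ _ _ _ _ _)) (.and (.eqN _ _) (.and (.mem5 _ _ _ _ _ _)
      (.allLt _ (.exLt _ (.and (.pr1 _ _ _) (.and (.mem5 _ _ _ _ _ _) (.mem5 _ _ _ _ _ _))))))))
    (scons t I.envN) (scons R I.envS) (q + 1 + 1) I.n I.l
  simp only [Str.sat_or, Str.sat_and, Str.sat_le, Str.sat_eqN, sat_mem5, sat_allLt, sat_exLt,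
    Inst.sat_pr1, Inst.eval_up, Inst.eval_upS, eval_generic, Str.val_add, Str.val_one,
    Str.val_var, scons_zero, scons_succ] at h
  have hne : ∀ {x : M.N}, x ≤ t + 1 → x ≠ t + 1 + 1 := fun hx => (lt_succ_iff.2 hx).ne
  have hlt : ∀ {x : M.N}, x ≤ t + 1 → x < q + 1 + 1 := fun hx =>
    lt_succ_iff.2 ((hx.trans ht).trans le_self_add)
  have hold : ∀ r ≤ t + 1, I.AllEdge fun i j a b =>
      M.mem (tuple r i j a b) R ↔ M.mem (tuple r i j a b) R' := by
    intro r hr i hi j hj a ha b hb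
    simp only [h r (hlt hr) i hi j hj a ha b hb, hr, hne hr, true_and, false_and, or_false]
  have hnew : I.AllEdge fun i j a b =>
      M.mem (tuple (t + 1 + 1) i j a b) R' ↔ I.Step R (t + 1) i j a b := by
    intro i hi j hj a ha b hb
    have hn : ¬ t + 1 + 1 ≤ t + 1 := fun h => (succ_le_iff.1 h).false
    have hl : t + 1 + 1 < q + 1 + 1 := lt_succ_iff.2 (by gcongr)
    simp only [h _ hl i hi j hj a ha b hb, hn, true_and, false_and, false_or]
    exact Iff.rfl
  refine ⟨R', hlen, fun i hi j hj a ha b hb => ?_, fun r hr hr1 i hi j hj a ha b hb => ?_⟩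
  · exact (hold 1 le_add_self i hi j hj a ha b hb).symm.trans (hR.base i hi j hj a ha b hb)
  · refine Iff.trans ?_ (Step.congr I (hold r hr) i hi j hj a ha b hb)
    rcases hr.lt_or_eq with hlt | rfl
    · have hrt := lt_succ_iff.1 hlt
      exact (hold (r + 1) (by gcongr) i hi j hj a ha b hb).symm.trans
        (hR.step r hrt hr1 i hi j hj a ha b hb)
    · exact hnew i hi j hj a ha b hb

theorem exists_isPropagation (E₁ : M.S) (q : M.N) : ∃ R, I.IsPropagation E₁ R q := by
  have hsat : ∀ t, M.Sat (scons t (scons q (scons (tuple (q + 1 + 1) I.n I.n I.l I.l) I.envN)))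
      (scons E₁ I.envS) (♯0 ≤ᶠ ♯1 →ᶠ
        exSLe ♯2 (generic.upS.upS.up.up.up.isPropagation 1 0 ♯0)) ↔
      (t ≤ q → ∃ R, M.len R ≤ tuple (q + 1 + 1) I.n I.n I.l I.l ∧ I.IsPropagation E₁ R t) := by
    intro t
    simp only [Str.sat_imp, Str.sat_le, Str.sat_exSLe, Inst.sat_isPropagation, Inst.eval_up,
      Inst.eval_upS, eval_generic, Str.val_var, scons_zero, scons_succ]
  have := ind (.imp (.of0 (.le _ _)) (.exSLe _ (.of0 (.isPropagation _ _ _ _))))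
    _ _ ((hsat 0).2 fun _ => ?_) (fun t ih => (hsat (t + 1)).2 fun ht => ?_) q
  · obtain ⟨R, -, hR⟩ := (hsat q).1 this le_rfl
    exact ⟨R, hR⟩
  -- At `t = 0` only $R_1$ is prescribed, because no index satisfies $1\le t\le 0$. The set copies
  -- the edges of `E₁` into every stage.
  · obtain ⟨R, hlen, h⟩ := comp_tuple (φ := memEdge 0 ♯3 ♯1 ♯2 ♯0) (.memEdge _ _ _ _ _)
      e₀ (scons E₁ s₀) (q + 1 + 1) I.n I.l
    simp only [sat_memEdge, Str.val_var, scons_zero, scons_succ] at h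
    refine ⟨R, hlen, fun i hi j hj a ha b hb =>
      h 1 (lt_succ_iff.2 le_add_self) i hi j hj a ha b hb, fun t ht ht1 => ?_⟩
    exact (zero_lt_one.not_ge (ht1.trans ht)).elim
  · obtain ⟨R, -, hR⟩ := (hsat t).1 ih (le_self_add.trans ht)
    exact I.exists_isPropagation_succ ht hR

theorem exists_isCC : ∃ V' E', I.IsCC V' E' := by
  obtain ⟨V₁, E₁, h₁⟩ := I.exists_isR1
  obtain ⟨C, hC⟩ := exists_isCensus E₁ (M.len E₁)
  obtain ⟨q, hq, hm, -⟩ := hC.total _ le_rfl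
  obtain ⟨R, hR⟩ := I.exists_isPropagation E₁ q
  obtain ⟨V', E', hF⟩ := I.exists_isFinal R (q + 1)
  exact ⟨V', E', V₁, E₁, C, R, h₁, hC, q, hq, hm, hR, hF⟩

end MInst
end BA

namespace BA

open V1Model

/-! ## Soundness of the reduction -/

/-- `H(i, ⟨i, a⟩)` -/
def memValue (H : ℕ) (i a : Term) : Fml :=
  exLt (.len H) (isPair i.up a.up ♯0 ∧ᶠ mem2 H i.up ♯0)

theorem Sigma0.memValue (H : ℕ) (i a : Term) : Sigma0 (memValue H i a) :=
  exLt _ (and (isPair _ _ _) (mem2 _ _ _))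

theorem sat_memValue {M : V1Model} (e : ℕ → M.N) (s : ℕ → M.S) (H : ℕ) (i a : Term) :
    M.Sat e s (memValue H i a) ↔
      M.mem (pair (M.val e s i) (pair (M.val e s i) (M.val e s a))) (s H) := by
  simp only [memValue, sat_exLt, Str.sat_and, sat_isPair, sat_mem2, Str.val_up, Str.val_var,
    scons_zero, Str.val_len]
  refine ⟨?_, fun h => ⟨_, (right_le_pair _ _).trans_lt (lt_len h), rfl, h⟩⟩
  rintro ⟨_, -, rfl, h⟩
  exact h

namespace MInst

variable {M : V1Model} {I : MInst M}

theorem IsTarget.exists_of_mem_V (hI : I.IsTarget) {z : M.N} (hz : M.mem z I.V) :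
    ∃ i < I.n, ∃ a < I.l, z = pair i a := hI.mem_V z (lt_len hz) hz

theorem IsTarget.lt_pair (hI : I.IsTarget) {z : M.N} (hz : M.mem z I.V) :
    z < pair I.n I.l := by
  obtain ⟨i, hi, a, ha, rfl⟩ := hI.exists_of_mem_V hz
  exact pair_lt_pair hi ha.le

/-- The domain clause of a homomorphism concerns only values below $\langle n,l\rangle$; elements of
`V` are that small because the target is well formed. -/
theorem IsHom.exists_value (hI : I.IsInput) (hT : I.IsTarget) {H : M.S}
    (hH : I.IsHom (pair I.n I.l) H) {i : M.N} (hi : i < I.n) :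
    ∃ a < I.l, I.Dom i a ∧ M.mem (pair i (pair i a)) H := by
  obtain ⟨z, -, hz, hm⟩ := hH.total i (by rwa [hI.len_VX]) (hI.mem_VX i hi)
  obtain ⟨a, ha, rfl, hd⟩ := hH.dom i hi z (hT.lt_pair hz) hm
  exact ⟨a, ha, hd, hm⟩

theorem IsHom.dom_of_mem {H : M.S} (hH : I.IsHom (pair I.n I.l) H) {i a : M.N} (hi : i < I.n)
    (ha : a < I.l) (hm : M.mem (pair i (pair i a)) H) : I.Dom i a := by
  obtain ⟨a', -, heq, hd⟩ := hH.dom i hi _ (pair_lt_pair hi ha.le) hm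
  obtain ⟨-, rfl⟩ := pair_inj.1 heq
  exact hd

theorem IsHom.edge0 {H : M.S} (hH : I.IsHom (pair I.n I.l) H) {i j a b : M.N} (hi : i < I.n)
    (hj : j < I.n) (ha : a < I.l) (hb : b < I.l) (hma : M.mem (pair i (pair i a)) H)
    (hmb : M.mem (pair j (pair j b)) H) : I.Edge0 i j a b :=
  ⟨⟨hH.dom_of_mem hi ha hma, hH.dom_of_mem hj hb hmb⟩,
    fun h => hH.edge i hi j hj _ (pair_lt_pair hi ha.le) _ (pair_lt_pair hj hb.le) ⟨h, hma, hmb⟩,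
    fun h => hH.edge j hj i hi _ (pair_lt_pair hj hb.le) _ (pair_lt_pair hi ha.le) ⟨h, hmb, hma⟩⟩

/-- The values of `H` at the neighbours of `i` are the required supports for `a`. -/
theorem IsHom.pr1 (hI : I.IsInput) (hT : I.IsTarget) {H : M.S}
    (hH : I.IsHom (pair I.n I.l) H) {i a : M.N} (hi : i < I.n) (ha : a < I.l)
    (hm : M.mem (pair i (pair i a)) H) : I.Pr1 i a := by
  refine ⟨hH.dom_of_mem hi ha hm, fun j hj _ => ?_, fun k hk _ => ?_⟩
  · obtain ⟨b, hb, hd, hmb⟩ := hH.exists_value hI hT hj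
    exact ⟨b, hb, hd, hH.edge0 hi hj ha hb hm hmb⟩
  · obtain ⟨c, hc, hd, hmc⟩ := hH.exists_value hI hT hk
    exact ⟨c, hc, hd, hH.edge0 hk hi hc ha hmc hm⟩

/-- The values of a solution survive every step of the propagation. -/
theorem IsHom.mem_propagation (hI : I.IsInput) (hT : I.IsTarget) {V₁ E₁ R H : M.S} {q : M.N}
    (h₁ : I.IsR1 V₁ E₁) (hR : I.IsPropagation E₁ R q) (hH : I.IsHom (pair I.n I.l) H) (t : M.N) :
    t ≤ q → I.AllEdge fun i j a b => M.mem (pair i (pair i a)) H → M.mem (pair j (pair j b)) H →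
      M.mem (tuple (t + 1) i j a b) R := by
  have hsat : ∀ t, M.Sat (scons t (scons q I.envN)) (scons R (scons H I.envS)) (♯0 ≤ᶠ ♯1 →ᶠ
      generic.upS.upS.up.up.allEdge (memValue 1 ♯3 ♯1 →ᶠ memValue 1 ♯2 ♯0 →ᶠ
        mem5 0 (♯4 +ᶠ .one) ♯3 ♯2 ♯1 ♯0)) ↔
      (t ≤ q → I.AllEdge fun i j a b => M.mem (pair i (pair i a)) H →
        M.mem (pair j (pair j b)) H → M.mem (tuple (t + 1) i j a b) R) := by
    intro t
    simp only [Str.sat_imp, Str.sat_le, Inst.sat_allEdge, Inst.eval_up, Inst.eval_upS, sat_mem5,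
      sat_memValue, eval_generic, Str.val_add, Str.val_one, Str.val_var, scons_zero, scons_succ]
  refine (hsat t).1 (ind (.of0 (.imp (.le _ _) (.allEdge _ (.imp (.memValue _ _ _)
    (.imp (.memValue _ _ _) (.mem5 _ _ _ _ _ _)))))) _ _
    ((hsat 0).2 fun _ i hi j hj a ha b hb hma hmb => ?_)
    (fun t ih => (hsat (t + 1)).2 fun ht i hi j hj a ha b hb hma hmb => ?_) t)
  · rw [zero_add]
    exact (hR.base i hi j hj a ha b hb).2 ((h₁.mem_E i hi j hj a ha b hb).2
      ⟨hH.pr1 hI hT hi ha hma, hH.pr1 hI hT hj hb hmb, hH.edge0 hi hj ha hb hma hmb⟩)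
  · have ih := (hsat t).1 ih (le_self_add.trans ht)
    refine (hR.step (t + 1) ht le_add_self i hi j hj a ha b hb).2
      ⟨ih i hi j hj a ha b hb hma hmb, fun k hk => ?_⟩
    -- The value of `H` at `k` closes the triangle: the induction hypothesis applies to both pairs
    -- that contain it.
    obtain ⟨c, hc, -, hmc⟩ := hH.exists_value hI hT hk
    exact ⟨c, hc, hH.pr1 hI hT hk hc hmc, ih i hi k hk a ha c hc hma hmc,
      ih k hk j hj c hc b hb hmc hmb⟩

/-- The relations of the propagation sequence decrease. -/
theorem IsPropagation.mem_one {E₁ R : M.S} {q : M.N} (hR : I.IsPropagation E₁ R q) (t : M.N) :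
    t ≤ q → I.AllEdge fun i j a b => M.mem (tuple (t + 1) i j a b) R →
      M.mem (tuple 1 i j a b) R := by
  have hsat : ∀ t, M.Sat (scons t (scons q I.envN)) (scons R I.envS) (♯0 ≤ᶠ ♯1 →ᶠ
      generic.upS.up.up.allEdge (mem5 0 (♯4 +ᶠ .one) ♯3 ♯2 ♯1 ♯0 →ᶠ
        mem5 0 .one ♯3 ♯2 ♯1 ♯0)) ↔
      (t ≤ q → I.AllEdge fun i j a b => M.mem (tuple (t + 1) i j a b) R →
        M.mem (tuple 1 i j a b) R) := by
    intro t
    simp only [Str.sat_imp, Str.sat_le, Inst.sat_allEdge, Inst.eval_up, Inst.eval_upS, sat_mem5,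
      eval_generic, Str.val_add, Str.val_one, Str.val_var, scons_zero, scons_succ]
  refine (hsat t).1 (ind (.of0 (.imp (.le _ _) (.allEdge _ (.imp (.mem5 _ _ _ _ _ _)
    (.mem5 _ _ _ _ _ _))))) _ _ ((hsat 0).2 fun _ i hi j hj a ha b hb h => ?_)
    (fun t ih => (hsat (t + 1)).2 fun ht i hi j hj a ha b hb h => ?_) t)
  · rwa [zero_add] at h
  · exact (hsat t).1 ih (le_self_add.trans ht) i hi j hj a ha b hb
      ((hR.step (t + 1) ht le_add_self i hi j hj a ha b hb).1 h).1

-- Transfer of solutions in both directions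

section Transfer

variable {V₁ E₁ R V' E' : M.S} {q : M.N}

theorem IsFinal.mem_V_of_mem {t : M.N} (hF : I.IsFinal R t V' E') {z : M.N} (hz : M.mem z V') :
    M.mem z I.V := by
  obtain ⟨i, hi, a, ha, rfl⟩ := hF.isTarget.exists_of_mem_V hz
  exact ((hF.mem_V i hi a ha).1 hz).1.1

/-- The same `H` works. Its values support one another in $R_{q+1}$, so they all lie in the reduced
domains; the length bound is unchanged because the reduction keeps $n$ and $l$. -/
theorem hasSolution_withTarget (hI : I.IsInput) (hT : I.IsTarget) (h₁ : I.IsR1 V₁ E₁)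
    (hR : I.IsPropagation E₁ R q) (hF : I.IsFinal R (q + 1) V' E') (h : I.HasSolution) :
    (I.withTarget V' E').HasSolution := by
  obtain ⟨H, hlen, hH⟩ := h
  have hmem := hH.mem_propagation hI hT h₁ hR q le_rfl
  have hcc : ∀ i < I.n, ∀ a < I.l, M.mem (pair i (pair i a)) H → I.PrCC R (q + 1) i a := by
    refine fun i hi a ha hm => ⟨hH.pr1 hI hT hi ha hm, fun j hj _ => ?_, fun k hk _ => ?_⟩
    · obtain ⟨b, hb, hd, hmb⟩ := hH.exists_value hI hT hj
      exact ⟨b, hb, hH.pr1 hI hT hj hb hmb, hmem i hi j hj a ha b hb hm hmb⟩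
    · obtain ⟨c, hc, hd, hmc⟩ := hH.exists_value hI hT hk
      exact ⟨c, hc, hH.pr1 hI hT hk hc hmc, hmem k hk i hi c hc a ha hmc hm⟩
  refine ⟨H, hlen, fun i hi _ => ?_, fun i hi hiV z _ hz w _ hw h => ?_, fun i hi z hz hm => ?_,
    fun i hi j hj z hz w hw h => ?_⟩
  · have hi' : i < I.n := hI.len_VX ▸ hi
    obtain ⟨a, ha, hd, hm⟩ := hH.exists_value hI hT hi'
    have hV := (hF.mem_V i hi' a ha).2 (hcc i hi' a ha hm)
    exact ⟨_, lt_len hV, hV, hm⟩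
  · have hz' := hF.mem_V_of_mem hz
    have hw' := hF.mem_V_of_mem hw
    exact hH.unique i hi hiV z (lt_len hz') hz' w (lt_len hw') hw' h
  · obtain ⟨a, ha, rfl, -⟩ := hH.dom i hi z hz hm
    exact ⟨a, ha, rfl, (hF.mem_V i hi a ha).2 (hcc i hi a ha hm)⟩
  · obtain ⟨a, ha, rfl, -⟩ := hH.dom i hi z hz h.2.1
    obtain ⟨b, hb, rfl, -⟩ := hH.dom j hj w hw h.2.2
    exact (hF.mem_E i hi j hj a ha b hb).2 ⟨⟨hcc i hi a ha h.2.1, hcc j hj b hb h.2.2⟩,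
      hmem i hi j hj a ha b hb h.2.1 h.2.2⟩

/-- The same `H` works, since the reduced domains shrink the original ones and $R_{q+1}\subseteq
R_1\subseteq E_0$, where $E_0$ respects the edges of the input. -/
theorem hasSolution_of_withTarget (hI : I.IsInput) (hT : I.IsTarget) (h₁ : I.IsR1 V₁ E₁)
    (hR : I.IsPropagation E₁ R q) (hF : I.IsFinal R (q + 1) V' E')
    (h : (I.withTarget V' E').HasSolution) : I.HasSolution := by
  obtain ⟨H, hlen, hH⟩ := h
  refine ⟨H, hlen, fun i hi hiV => ?_, fun i hi hiV z _ hz w _ hw h => ?_, fun i hi z hz hm => ?_,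
    fun i hi j hj z hz w hw h => ?_⟩
  · obtain ⟨z, -, hz, hm⟩ := hH.total i hi hiV
    have hz' := hF.mem_V_of_mem hz
    exact ⟨z, lt_len hz', hz', hm⟩
  · have hi' : i < I.n := hI.len_VX ▸ hi
    -- Uniqueness of the given `H` concerns only values in `V'`; a value in `V` is brought there by
    -- the domain clause for the reduced instance.
    have hV : ∀ z, M.mem z I.V → M.mem (pair i z) H → M.mem z V' := by
      intro z hz hm
      obtain ⟨a, -, rfl, hd⟩ := hH.dom i hi' z (hT.lt_pair hz) hm
      exact hd
    have hz' := hV z hz h.1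
    have hw' := hV w hw h.2
    exact hH.unique i hi hiV z (lt_len hz') hz' w (lt_len hw') hw' h
  · obtain ⟨a, ha, rfl, hd⟩ := hH.dom i hi z hz hm
    exact ⟨a, ha, rfl, hF.mem_V_of_mem hd⟩
  · obtain ⟨a, ha, rfl, -⟩ := hH.dom i hi z hz h.2.1
    obtain ⟨b, hb, rfl, -⟩ := hH.dom j hj w hw h.2.2
    have hE := hH.edge i hi j hj _ hz _ hw h
    have hmem := hR.mem_one q le_rfl i hi j hj a ha b hb ((hF.mem_E i hi j hj a ha b hb).1 hE).2
    exact ((h₁.mem_E i hi j hj a ha b hb).1 ((hR.base i hi j hj a ha b hb).1 hmem)).2.2.2.1 h.1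

end Transfer

theorem IsCC.hasSolution_iff (hI : I.IsInput) (hT : I.IsTarget) {V' E' : M.S}
    (h : I.IsCC V' E') : I.HasSolution ↔ (I.withTarget V' E').HasSolution := by
  obtain ⟨V₁, E₁, C, R, h₁, -, q, -, -, hR, hF⟩ := h
  exact ⟨hasSolution_withTarget hI hT h₁ hR hF, hasSolution_of_withTarget hI hT h₁ hR hF⟩

end MInst

theorem V1Model.sat_ccSoundness (M : V1Model) (e : ℕ → M.N) (s : ℕ → M.S) :
    M.Sat e s ccSoundness := by
  intro n l VX EX V E
  simp only [Inst.isInstance, Str.sat_imp, Str.sat_and, Inst.sat_isInput, Inst.sat_isTarget,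
    Str.sat_exS, Str.sat_allS, Str.sat_iff, Inst.sat_isCC, Inst.sat_hasSolution,
    Inst.eval_withTarget, Inst.eval_upS, scons_zero, scons_succ]
  exact fun ⟨hI, hT⟩ => ⟨MInst.exists_isCC _, fun V' E' h => h.hasSolution_iff hI hT⟩

end BA

theorem mainTheorem2 : BA.Proves BA.V1 [] BA.ccSoundness :=
  BA.proves_of_forall_model fun M hM e s => BA.V1Model.sat_ccSoundness ⟨M, hM⟩ e s
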